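/- Let $\Bbbk$ be a field. For coalgebras $C,D$ over $\Bbbk$, let $D^C$ denote the measuring coalgebra, i.e. the cocommutative coalgebra with an evaluation morphism $D^C\otimes C\to D$, $u\otimes c\mapsto u@c$, representing the functor $R\mapsto\mathrm{Coalg}(R^*\otimes C,D)$ on finite-dimensional commutative $\Bbbk$-algebras; concretely, it is the colimit of all finite-dimensional cocommutative coalgebras $B$ equipped with a coalgebra morphism $B\otimes C\to D$. If $A,Q$ are cocommutative Hopf algebras over $\Bbbk$, then $A^Q$ is a Hopf algebra with $(uv)@c=\sum(u@c_1)(v@c_2)$, $1@c=\varepsilon(c)1$ and $S(u)@c=S(u@c)$, the Hopf algebra $Q$ acts on it by $(q\star u)@c=u@(cq)$, and the wreath product $A\wr Q$ is the smash product $A^Q\#Q$, namely the coalgebra $A^Q\otimes Q$ with multiplication $(u\#q)(v\#r)=\sum u(q_1\star v)\#q_2r$. For a group $G$, the group ring $\Bbbk G$ is a Hopf algebra with $\Delta(g)=g\otimes g$ for all $g\in G$. For groups $\mathfrak A,\mathfrak Q$, let $\mathfrak A\wr\mathfrak Q=\mathfrak A^{\mathfrak Q}\rtimes\mathfrak Q$,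 where $\mathfrak A^{\mathfrak Q}$ is the group of all functions $\mathfrak Q\to\mathfrak A$ and $\mathfrak Q$ acts by $(q\cdot f)(x)=f(xq)$. (1) For all groups $\mathfrak A,\mathfrak Q$, there is an isomorphism of Hopf algebras $\Bbbk\mathfrak A\wr\Bbbk\mathfrak Q\cong\Bbbk(\mathfrak A\wr\mathfrak Q)$. (2) For all sets $X,Y$, with group-like coalgebras $\Bbbk X,\Bbbk Y$ ($\Delta(x)=x\otimes x$ and $\varepsilon(x)=1$ for $x\in X$, and similarly for $Y$), the coalgebras $(\Bbbk Y)^{\Bbbk X}$ and $\Bbbk(Y^X)$ are isomorphic. -/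

import Mathlib

open scoped TensorProduct

noncomputable section

namespace HopfWreath

open Coalgebra

universe u v w x

section FiniteDimensional

variable {k : Type u} [Field k]

/-- The vector space `k ^ n`, without its pointwise coalgebra structure. -/
def Vec (k : Type u) (n : ℕ) : Type u := Fin n → k

instance (n : ℕ) : AddCommGroup (Vec k n) := inferInstanceAs (AddCommGroup (Fin n → k))
instance (n : ℕ) : Module k (Vec k n) := inferInstanceAs (Module k (Fin n → k))
instance (n : ℕ) : FiniteDimensional k (Vec k n) :=
  inferInstanceAs (FiniteDimensional k (Fin n → k))

/-- A coalgebra structure pulled back along an injective linear map. -/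
abbrev coalgebraOfInjective {V : Type v} {B : Type w} [AddCommGroup V] [Module k V]
    [AddCommGroup B] [Module k B] [Coalgebra k B] (j : V →ₗ[k] B) (hj : Function.Injective j)
    (δ : V →ₗ[k] V ⊗[k] V) (hδ : TensorProduct.map j j ∘ₗ δ = comul ∘ₗ j) : Coalgebra k V where
  comul := δ
  counit := counit ∘ₗ j
  coassoc := by
    have h2 : Function.Injective (TensorProduct.map j (TensorProduct.map j j)) :=
      TensorProduct.map_injective_of_flat_flat _ _ hj
        (TensorProduct.map_injective_of_flat_flat _ _ hj hj)
    refine LinearMap.ext fun y => h2 ?_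
    have e0 : ∀ (t : V ⊗[k] V) (b : V), TensorProduct.map j (TensorProduct.map j j)
        (TensorProduct.assoc k V V V (t ⊗ₜ b)) =
        TensorProduct.assoc k B B B (TensorProduct.map j j t ⊗ₜ j b) := by
      intro t b
      induction t with
      | zero => simp
      | add y z hy hz => simp only [map_add, TensorProduct.add_tmul, hy, hz]
      | tmul y z => simp
    have e1 : TensorProduct.map j (TensorProduct.map j j) ∘ₗ
        (TensorProduct.assoc k V V V).toLinearMap ∘ₗ δ.rTensor V ∘ₗ δ =
        (TensorProduct.assoc k B B B).toLinearMap ∘ₗ (comul (R := k) (A := B)).rTensor B ∘ₗ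
          comul ∘ₗ j := by
      rw [← hδ]
      simp only [← LinearMap.comp_assoc]
      congr 1
      ext a b
      have := LinearMap.congr_fun hδ a
      simp only [LinearMap.comp_apply] at this
      simp [← this, e0]
    have e2 : TensorProduct.map j (TensorProduct.map j j) ∘ₗ δ.lTensor V ∘ₗ δ =
        (comul (R := k) (A := B)).lTensor B ∘ₗ comul ∘ₗ j := by
      rw [← hδ, ← LinearMap.comp_assoc, ← LinearMap.comp_assoc]
      congr 1
      ext a b
      have := LinearMap.congr_fun hδ b
      simp only [LinearMap.comp_apply] at this
      simp [this]
    have := (LinearMap.congr_fun e1 y).trans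
      ((Coalgebra.coassoc_apply (R := k) (j y)).trans (LinearMap.congr_fun e2 y).symm)
    exact this
  rTensor_counit_comp_comul := by
    have hi : Function.Injective (TensorProduct.map (LinearMap.id : k →ₗ[k] k) j) :=
      TensorProduct.map_injective_of_flat_flat _ _ Function.injective_id hj
    refine LinearMap.ext fun y => hi ?_
    have e1 : TensorProduct.map (LinearMap.id : k →ₗ[k] k) j ∘ₗ
        ((counit (R := k) (A := B)) ∘ₗ j).rTensor V ∘ₗ δ =
        (counit (R := k) (A := B)).rTensor B ∘ₗ comul ∘ₗ j := by
      rw [← hδ, ← LinearMap.comp_assoc, ← LinearMap.comp_assoc]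
      congr 1
      ext a b
      simp
    refine (LinearMap.congr_fun e1 y).trans ?_
    simp
  lTensor_counit_comp_comul := by
    have hi : Function.Injective (TensorProduct.map j (LinearMap.id : k →ₗ[k] k)) :=
      TensorProduct.map_injective_of_flat_flat _ _ hj Function.injective_id
    refine LinearMap.ext fun y => hi ?_
    have e1 : TensorProduct.map j (LinearMap.id : k →ₗ[k] k) ∘ₗ
        ((counit (R := k) (A := B)) ∘ₗ j).lTensor V ∘ₗ δ =
        (counit (R := k) (A := B)).lTensor B ∘ₗ comul ∘ₗ j := by
      rw [← hδ, ← LinearMap.comp_assoc, ← LinearMap.comp_assoc]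
      congr 1
      ext a b
      simp
    refine (LinearMap.congr_fun e1 y).trans ?_
    simp

variable {B : Type v} [AddCommGroup B] [Module k B] [Coalgebra k B]

/-- `V` is a subcoalgebra of `B`. -/
def IsSubcoalgebra (V : Submodule k B) : Prop :=
  ∀ b ∈ V, comul (R := k) b ∈ LinearMap.range (TensorProduct.map V.subtype V.subtype)

lemma IsSubcoalgebra.sup {V W : Submodule k B} (hV : IsSubcoalgebra V) (hW : IsSubcoalgebra W) :
    IsSubcoalgebra (V ⊔ W) := by
  have key : ∀ {V' : Submodule k B}, IsSubcoalgebra V' → V' ≤ V ⊔ W → ∀ b ∈ V',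
      comul (R := k) b ∈
        LinearMap.range (TensorProduct.map (V ⊔ W).subtype (V ⊔ W).subtype) := by
    intro V' hV' hle b hb
    obtain ⟨y, hy⟩ := hV' b hb
    refine ⟨TensorProduct.map (Submodule.inclusion hle) (Submodule.inclusion hle) y, ?_⟩
    rw [← hy, ← LinearMap.comp_apply, ← TensorProduct.map_comp]
    rfl
  intro b hb
  obtain ⟨y, hy, z, hz, rfl⟩ := Submodule.mem_sup.1 hb
  rw [map_add]
  exact add_mem (key hV le_sup_left y hy) (key hW le_sup_right z hz)

/-- A tensor all of whose right contractions lie in `V` is fixed by a projection onto `V`. -/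
lemma rTensor_eq_self (V : Submodule k B) (p : B →ₗ[k] B) (hp : ∀ b ∈ V, p b = b)
    (t : B ⊗[k] B)
    (ht : ∀ β : B →ₗ[k] k, TensorProduct.rid k B (β.lTensor B t) ∈ V) :
    p.rTensor B t = t := by
  classical
  let bs := Module.Basis.ofVectorSpace k B
  have hc : ∀ (t : B ⊗[k] B) i, TensorProduct.equivFinsuppOfBasisRight bs t i =
      TensorProduct.rid k B ((bs.coord i).lTensor B t) := by
    intro t i
    induction t with
    | zero => simp
    | add y z hy hz => simp [hy, hz]
    | tmul y z => simp [TensorProduct.equivFinsuppOfBasisRight_apply_tmul]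
  have hcomm : ∀ (t : B ⊗[k] B) (β : B →ₗ[k] k),
      TensorProduct.rid k B (β.lTensor B (p.rTensor B t)) =
      p (TensorProduct.rid k B (β.lTensor B t)) := by
    intro t β
    induction t with
    | zero => simp
    | add y z hy hz => simp only [map_add, hy, hz]
    | tmul y z => simp
  apply (TensorProduct.equivFinsuppOfBasisRight (M := B) bs).injective
  ext i
  rw [hc, hc, hcomm, hp _ (ht _)]

/-- Every element of a cocommutative coalgebra lies in a finite-dimensional subcoalgebra. -/
lemma exists_subcoalgebra_mem [IsCocomm k B] (b : B) :
    ∃ V : Submodule k B, V.FG ∧ IsSubcoalgebra V ∧ b ∈ V := by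
  -- the orbit of `b` under contraction with functionals
  let c : B ⊗[k] B →ₗ[k] (B →ₗ[k] k) →ₗ[k] B :=
    (LinearMap.compr₂ (LinearMap.lTensorHom B) (TensorProduct.rid k B).toLinearMap).flip
  have hc : ∀ t β, c t β = TensorProduct.rid k B (β.lTensor B t) := by
    intro t β
    simp [c]
  let V : Submodule k B := LinearMap.range (c (comul b))
  have hfg : ∀ t, (LinearMap.range (c t)).FG := by
    intro t
    rw [← Module.Finite.iff_fg]
    induction t with
    | zero => rw [map_zero, LinearMap.range_zero]; infer_instance
    | add y z hy hz =>
      refine Submodule.finiteDimensional_of_le (S₂ := LinearMap.range (c y) ⊔ LinearMap.range (c z)) ?_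
      rintro _ ⟨β, rfl⟩
      rw [map_add]
      exact Submodule.add_mem_sup ⟨β, rfl⟩ ⟨β, rfl⟩
    | tmul y z =>
      refine Submodule.finiteDimensional_of_le (S₂ := k ∙ y) ?_
      rintro _ ⟨β, rfl⟩
      rw [hc]
      simpa using Submodule.smul_mem _ _ (Submodule.mem_span_singleton_self y)
  refine ⟨V, hfg _, ?_, ⟨counit, ?_⟩⟩
  · obtain ⟨q, hq⟩ := V.exists_isCompl
    let p : B →ₗ[k] V := V.projectionOnto q hq
    let p' : B →ₗ[k] B := V.subtype ∘ₗ p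
    have hp' : ∀ y ∈ V, p' y = y := fun y hy => by
      simpa [p', p] using congrArg Subtype.val (Submodule.projectionOnto_apply_left hq ⟨y, hy⟩)
    rintro _ ⟨α, rfl⟩
    have hcontr : ∀ β : B →ₗ[k] k,
        TensorProduct.rid k B (β.lTensor B (comul (R := k) (c (comul b) α))) ∈ V := by
      intro β
      refine ⟨LinearMap.mul' k k ∘ₗ TensorProduct.map β α ∘ₗ comul, ?_⟩
      rw [hc, hc]
      have h1 : ∀ t : B ⊗[k] B, TensorProduct.rid k B (β.lTensor B (comul (R := k)
          (TensorProduct.rid k B (α.lTensor B t)))) =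
          TensorProduct.rid k B ((LinearMap.mul' k k ∘ₗ TensorProduct.map β α).lTensor B
            (TensorProduct.assoc k B B B ((comul (R := k) (A := B)).rTensor B t))) := by
        intro t
        induction t with
        | zero => simp
        | add y z hy hz => simp only [map_add, hy, hz]
        | tmul y z =>
          simp only [LinearMap.lTensor_tmul, LinearMap.rTensor_tmul, TensorProduct.rid_tmul,
            map_smul]
          induction comul (R := k) y with
          | zero => simp
          | add y z hy hz => simp only [map_add, TensorProduct.add_tmul, smul_add, hy, hz]
          | tmul y z' => simp [smul_smul, mul_comm]
      rw [h1, Coalgebra.coassoc_apply, ← LinearMap.lTensor_comp_apply, LinearMap.comp_assoc]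
    have h1 := rTensor_eq_self V p' hp' _ hcontr
    have h2 : p'.lTensor B (comul (R := k) (c (comul b) α)) = comul (R := k) (c (comul b) α) := by
      have hcm := Coalgebra.comm_comul k (c (comul b) α)
      conv_rhs => rw [← hcm, ← h1]
      conv_lhs => rw [← hcm]
      rw [LinearMap.rTensor, LinearMap.lTensor, TensorProduct.map_comm]
    refine ⟨TensorProduct.map p p (comul (R := k) (c (comul b) α)), ?_⟩
    rw [← LinearMap.comp_apply, ← TensorProduct.map_comp]
    change TensorProduct.map p' p' _ = _
    rw [← LinearMap.rTensor_comp_lTensor, LinearMap.comp_apply, h2, h1]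
  · rw [hc]
    simp

/-- Every finite-dimensional subspace lies in a finite-dimensional subcoalgebra. -/
lemma exists_subcoalgebra_ge [IsCocomm k B] (W : Submodule k B) (hW : W.FG) :
    ∃ V : Submodule k B, V.FG ∧ IsSubcoalgebra V ∧ W ≤ V := by
  induction W, hW using Submodule.fg_induction with
  | singleton b =>
    obtain ⟨V, h1, h2, h3⟩ := exists_subcoalgebra_mem (k := k) b
    exact ⟨V, h1, h2, by simpa using h3⟩
  | sup W₁ W₂ _ _ h h' =>
    obtain ⟨V, h1, h2, h3⟩ := h
    obtain ⟨V', h1', h2', h3'⟩ := h'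
    exact ⟨V ⊔ V', h1.sup h1', h2.sup h2', sup_le_sup h3 h3'⟩

/-- A finite-dimensional subcoalgebra, transported to some `Vec k n`. -/
lemma exists_vec_of_subcoalgebra [IsCocomm k B] (V : Submodule k B) (hV : V.FG)
    (h : IsSubcoalgebra V) :
    ∃ (n : ℕ) (_ : Coalgebra k (Vec k n)) (_ : IsCocomm k (Vec k n)) (j : Vec k n →ₗc[k] B),
      Function.Injective j ∧ LinearMap.range (j : Vec k n →ₗ[k] B) = V := by
  have : FiniteDimensional k V := Module.Finite.iff_fg.2 hV
  let e : V ≃ₗ[k] Vec k (Module.finrank k V) := (Module.finBasis k V).equivFun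
  let j : Vec k (Module.finrank k V) →ₗ[k] B := V.subtype ∘ₗ e.symm.toLinearMap
  have hj : Function.Injective j := V.injective_subtype.comp e.symm.injective
  have hr : LinearMap.range j = V := by
    rw [LinearMap.range_comp_of_range_eq_top _ e.symm.range, Submodule.range_subtype]
  have hjj : Function.Injective (TensorProduct.map j j) :=
    TensorProduct.map_injective_of_flat_flat _ _ hj hj
  have hle : ∀ y, comul (R := k) (j y) ∈ LinearMap.range (TensorProduct.map j j) := by
    intro y
    obtain ⟨t, ht⟩ := h (j y) (hr.le ⟨y, rfl⟩)
    refine ⟨TensorProduct.map e.toLinearMap e.toLinearMap t, ?_⟩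
    rw [← ht, ← LinearMap.comp_apply, ← TensorProduct.map_comp]
    congr 2 <;> · ext; simp [j]
  let δ : Vec k (Module.finrank k V) →ₗ[k] Vec k (Module.finrank k V) ⊗[k]
      Vec k (Module.finrank k V) :=
    (LinearEquiv.ofInjective _ hjj).symm.toLinearMap ∘ₗ
      LinearMap.codRestrict _ (comul ∘ₗ j) hle
  have hδ : TensorProduct.map j j ∘ₗ δ = comul ∘ₗ j := by
    ext1 y
    have := LinearEquiv.apply_symm_apply (LinearEquiv.ofInjective _ hjj)
      (LinearMap.codRestrict _ (comul ∘ₗ j) hle y)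
    exact congrArg Subtype.val this
  let _ := coalgebraOfInjective j hj δ hδ
  refine ⟨_, coalgebraOfInjective j hj δ hδ, ⟨?_⟩, { j with counit_comp := rfl, map_comp_comul := hδ }, hj, hr⟩
  refine LinearMap.ext fun y => hjj ?_
  have h1 := LinearMap.congr_fun hδ y
  change TensorProduct.map j j (TensorProduct.comm k _ _ (δ y)) = TensorProduct.map j j (δ y)
  rw [TensorProduct.map_comm]
  change TensorProduct.map j j (δ y) = comul (j y) at h1
  rw [h1, Coalgebra.comm_comul]

end FiniteDimensional

section Measuring

variable {k : Type u} [Field k]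

/-- A coalgebra morphism with image in a subcoalgebra factors through it. -/
lemma exists_factor {U : Type v} {V : Type w} {B : Type x} [AddCommGroup U] [Module k U]
    [Coalgebra k U] [AddCommGroup V] [Module k V] [Coalgebra k V] [AddCommGroup B] [Module k B]
    [Coalgebra k B] (j : U →ₗc[k] B) (hj : Function.Injective j) (g : V →ₗc[k] B)
    (h : ∀ y, ∃ z, j z = g y) : ∃ g' : V →ₗc[k] U, j.comp g' = g := by
  choose h' hh' using h
  let l : V →ₗ[k] U :=
    { toFun := h'
      map_add' := fun y z => hj (by simp [hh'])
      map_smul' := fun r y => hj (by simp [hh']) }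
  have hl : ∀ y, j (l y) = g y := hh'
  have hl' : (j : U →ₗ[k] B) ∘ₗ l = (g : V →ₗ[k] B) := LinearMap.ext hl
  refine ⟨{ l with counit_comp := ?_, map_comp_comul := ?_ }, CoalgHom.ext hl⟩
  · ext y
    have h1 := CoalgHomClass.counit_comp_apply (R := k) j (l y)
    have h2 := CoalgHomClass.counit_comp_apply (R := k) g y
    change counit (R := k) (l y) = counit y
    rw [← h1, hl, h2]
  · have hjj : Function.Injective (TensorProduct.map (j : U →ₗ[k] B) (j : U →ₗ[k] B)) :=
      TensorProduct.map_injective_of_flat_flat _ _ hj hj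
    refine LinearMap.ext fun y => hjj ?_
    have h1 := CoalgHomClass.map_comp_comul_apply (R := k) j (l y)
    have h2 := CoalgHomClass.map_comp_comul_apply (R := k) g y
    change TensorProduct.map (j : U →ₗ[k] B) (j : U →ₗ[k] B) (TensorProduct.map l l (comul y)) =
      TensorProduct.map (j : U →ₗ[k] B) (j : U →ₗ[k] B) (comul (l y))
    rw [h1, hl, ← h2, ← LinearMap.comp_apply, ← TensorProduct.map_comp, hl']

variable (k) (C : Type v) (D : Type w) [AddCommGroup C] [Module k C] [Coalgebra k C]
  [AddCommGroup D] [Module k D] [Coalgebra k D]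

/-- A finite-dimensional cocommutative coalgebra `B` (with underlying space `k ^ n`) together with
a coalgebra morphism `B ⊗ C → D`. Since finite-dimensional cocommutative coalgebras are the duals
`R^*` of the finite-dimensional commutative algebras `R`, these are the elements of the functor
`R ↦ Coalg(R^* ⊗ C, D)`. -/
structure Stage where
  /-- the dimension -/
  n : ℕ
  /-- the coalgebra structure -/
  [coalg : Coalgebra k (Vec k n)]
  [cocomm : IsCocomm k (Vec k n)]
  /-- the morphism to `D` -/
  f : Vec k n ⊗[k] C →ₗc[k] D

attribute [instance] Stage.coalg Stage.cocomm

/-- The direct sum of all the coalgebras indexing the colimit. -/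
abbrev StageSum : Type (max u v w) := Π₀ s : Stage k C D, Vec k s.n

variable {k C D} in
open Classical in
/-- The inclusion of a summand. -/
abbrev inStage (s : Stage k C D) : Vec k s.n →ₗ[k] StageSum k C D :=
  DFinsupp.lsingle (M := fun s : Stage k C D => Vec k s.n) s

/-- The identifications defining the colimit: `y` in one coalgebra is identified with `φ y` in
another one, for every coalgebra morphism `φ` compatible with the morphisms to `D`. -/
def relations : Submodule k (StageSum k C D) :=
  Submodule.span k { z | ∃ (s t : Stage k C D) (φ : Vec k s.n →ₗc[k] Vec k t.n) (y : Vec k s.n),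
    t.f.comp (φ.rTensor C) = s.f ∧ z = inStage s y - inStage t (φ y) }

open Classical in
instance : (relations k C D).IsCoideal where
  counit_eq_zero := by
    intro z hz
    change z ∈ LinearMap.ker (counit (R := k) (A := StageSum k C D))
    revert z
    change relations k C D ≤ _
    refine Submodule.span_le.2 ?_
    rintro _ ⟨s, t, φ, y, -, rfl⟩
    simp
  map_mkQ_comul_eq_zero := by
    intro z hz
    change z ∈ LinearMap.ker (TensorProduct.map (relations k C D).mkQ (relations k C D).mkQ ∘ₗ
      comul (R := k) (A := StageSum k C D))
    revert z
    change relations k C D ≤ _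
    refine Submodule.span_le.2 ?_
    rintro _ ⟨s, t, φ, y, h, rfl⟩
    have hφ : (relations k C D).mkQ ∘ₗ inStage t ∘ₗ (φ : Vec k s.n →ₗ[k] Vec k t.n) =
        (relations k C D).mkQ ∘ₗ inStage s := by
      ext1 z
      refine ((Submodule.Quotient.eq _).2 ?_).symm
      exact Submodule.subset_span ⟨s, t, φ, z, h, rfl⟩
    simp only [SetLike.mem_coe, LinearMap.mem_ker, map_sub, LinearMap.comp_apply,
      DFinsupp.lsingle_apply, DFinsupp.comul_single, ← CoalgHomClass.map_comp_comul_apply]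
    rw [TensorProduct.map_map, TensorProduct.map_map, TensorProduct.map_map, LinearMap.comp_assoc,
      hφ, sub_self]

/-- The measuring coalgebra `D ^ C`: the colimit of all finite-dimensional cocommutative
coalgebras `B` equipped with a coalgebra morphism `B ⊗ C → D`. -/
def MeasuringCoalgebra : Type (max u v w) :=
  StageSum k C D ⧸ relations k C D

namespace MeasuringCoalgebra

instance : AddCommGroup (MeasuringCoalgebra k C D) :=
  inferInstanceAs (AddCommGroup (StageSum k C D ⧸ relations k C D))

instance : Module k (MeasuringCoalgebra k C D) :=
  inferInstanceAs (Module k (StageSum k C D ⧸ relations k C D))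

open Classical in
instance : Coalgebra k (MeasuringCoalgebra k C D) :=
  inferInstanceAs (Coalgebra k (StageSum k C D ⧸ relations k C D))

variable {k C D}

variable (k C D) in
/-- The quotient map from the direct sum. -/
def mkL : StageSum k C D →ₗ[k] MeasuringCoalgebra k C D := (relations k C D).mkQ

open Classical in
lemma comul_mkL (z : StageSum k C D) :
    comul (R := k) (mkL k C D z) = TensorProduct.map (mkL k C D) (mkL k C D) (comul z) := rfl

open Classical in
lemma counit_mkL (z : StageSum k C D) : counit (R := k) (mkL k C D z) = counit z := rfl

open Classical in
/-- The structure morphisms of the colimit. -/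
def ι (s : Stage k C D) : Vec k s.n →ₗc[k] MeasuringCoalgebra k C D where
  toLinearMap := mkL k C D ∘ₗ inStage s
  counit_comp := by
    ext y
    simp [counit_mkL]
  map_comp_comul := by
    ext1 y
    simp only [LinearMap.comp_apply, comul_mkL, DFinsupp.lsingle_apply, DFinsupp.comul_single]
    rw [TensorProduct.map_map]

lemma ι_apply (s : Stage k C D) (y : Vec k s.n) : ι s y = mkL k C D (inStage s y) := rfl

lemma ι_apply_map {s t : Stage k C D} (φ : Vec k s.n →ₗc[k] Vec k t.n)
    (h : t.f.comp (φ.rTensor C) = s.f) (y : Vec k s.n) : ι t (φ y) = ι s y := by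
  refine ((Submodule.Quotient.eq _).2 ?_).symm
  exact Submodule.subset_span ⟨s, t, φ, y, h, rfl⟩

lemma induction_on {p : MeasuringCoalgebra k C D → Prop} (m : MeasuringCoalgebra k C D)
    (hz : p 0) (hι : ∀ s y, p (ι s y)) (hadd : ∀ m m', p m → p m' → p (m + m')) : p m := by
  classical
  obtain ⟨z, rfl⟩ : ∃ z, mkL k C D z = m := Submodule.Quotient.mk_surjective _ m
  induction z using DFinsupp.induction with
  | h0 => rwa [map_zero]
  | ha s y z _ _ ih => rw [map_add]; exact hadd _ _ (hι s y) ih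

instance : IsCocomm k (MeasuringCoalgebra k C D) where
  comm_comp_comul := by
    ext1 m
    induction m using induction_on with
    | hz => simp
    | hι s y =>
      have h := CoalgHomClass.map_comp_comul_apply (R := k) (ι s) y
      change TensorProduct.comm k _ _ (comul (ι s y)) = _
      rw [← h, ← TensorProduct.map_comm, Coalgebra.comm_comul]
    | hadd m m' h h' => rw [map_add, h, h', map_add]

lemma linearMap_ext {E : Type x} [AddCommMonoid E] [Module k E]
    {g g' : MeasuringCoalgebra k C D →ₗ[k] E} (h : ∀ s y, g (ι s y) = g' (ι s y)) : g = g' := by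
  ext m
  induction m using induction_on with
  | hz => simp
  | hι s y => exact h s y
  | hadd m m' h h' => rw [map_add, h, h', map_add]

open Classical in
/-- Evaluation, as a linear map `D ^ C → Hom(C, D)`. -/
def evLinear : MeasuringCoalgebra k C D →ₗ[k] (C →ₗ[k] D) :=
  Submodule.liftQ _ (DFinsupp.lsum k fun s : Stage k C D =>
    TensorProduct.curry (s.f : Vec k s.n ⊗[k] C →ₗ[k] D)) <| by
    refine Submodule.span_le.2 ?_
    rintro _ ⟨s, t, φ, y, h, rfl⟩
    simp only [SetLike.mem_coe, LinearMap.mem_ker, map_sub, sub_eq_zero]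
    ext c
    have := congr($h (y ⊗ₜ c))
    simpa using this.symm

lemma evLinear_ι (s : Stage k C D) (y : Vec k s.n) (c : C) :
    evLinear (ι s y) c = s.f (y ⊗ₜ c) := by
  classical
  have h : evLinear (ι s y) = (DFinsupp.lsum k fun s : Stage k C D =>
    TensorProduct.curry (s.f : Vec k s.n ⊗[k] C →ₗ[k] D)) (inStage s y) := rfl
  rw [h]
  simp

/-- The evaluation map `D ^ C ⊗ C → D`, `u ⊗ c ↦ u @ c`. -/
def ev : MeasuringCoalgebra k C D ⊗[k] C →ₗc[k] D where
  toLinearMap := TensorProduct.lift evLinear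
  counit_comp := by
    apply TensorProduct.curry_injective
    refine linearMap_ext fun s y => ?_
    ext c
    simp only [TensorProduct.curry_apply, LinearMap.comp_apply, TensorProduct.lift.tmul,
      evLinear_ι, CoalgHomClass.counit_comp_apply, TensorProduct.counit_tmul]
  map_comp_comul := by
    have h0 : ∀ s : Stage k C D, TensorProduct.lift (evLinear (k := k) (C := C) (D := D)) ∘ₗ
        TensorProduct.map (ι s : Vec k s.n →ₗ[k] _) LinearMap.id = (s.f : _ →ₗ[k] D) := by
      intro s
      ext y c
      simp [evLinear_ι]
    apply TensorProduct.curry_injective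
    refine linearMap_ext fun s y => ?_
    ext c
    have h1 := CoalgHomClass.map_comp_comul_apply (R := k) s.f (y ⊗ₜ c)
    have h2 := CoalgHomClass.map_comp_comul_apply (R := k) ((ι s).rTensor C) (y ⊗ₜ c)
    simp only [TensorProduct.curry_apply, LinearMap.comp_apply, TensorProduct.lift.tmul, evLinear_ι]
    rw [← h1, ← h0]
    change TensorProduct.map _ _ (comul (((ι s).rTensor C) (y ⊗ₜ[k] c))) = _
    rw [← h2, TensorProduct.map_comp]
    rfl

@[simp] lemma ev_ι (s : Stage k C D) (y : Vec k s.n) (c : C) :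
    ev (ι s y ⊗ₜ c) = s.f (y ⊗ₜ c) := evLinear_ι s y c

/-! ### The universal property -/

section Lift

variable {B : Type x} [AddCommGroup B] [Module k B] [Coalgebra k B]

/-- The element of the colimit diagram given by a morphism `V → B` and a morphism `B ⊗ C → D`. -/
abbrev stageOf {n : ℕ} [Coalgebra k (Vec k n)] [IsCocomm k (Vec k n)] (j : Vec k n →ₗc[k] B)
    (f : B ⊗[k] C →ₗc[k] D) : Stage k C D :=
  ⟨n, f.comp (j.rTensor C)⟩

lemma ι_stageOf_comp (f : B ⊗[k] C →ₗc[k] D) {n m : ℕ} [Coalgebra k (Vec k n)]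
    [IsCocomm k (Vec k n)] [Coalgebra k (Vec k m)] [IsCocomm k (Vec k m)]
    (j : Vec k n →ₗc[k] B) (i : Vec k m →ₗc[k] B) (φ : Vec k m →ₗc[k] Vec k n)
    (h : j.comp φ = i) (y : Vec k m) : ι (stageOf j f) (φ y) = ι (stageOf i f) y := by
  subst h
  refine ι_apply_map (s := stageOf (j.comp φ) f) (t := stageOf j f) φ ?_ y
  apply CoalgHom.coe_linearMap_injective
  apply TensorProduct.ext'
  intro y c
  rfl

variable [IsCocomm k B]

lemma exists_lift_apply (f : B ⊗[k] C →ₗc[k] D) (b : B) :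
    ∃ m : MeasuringCoalgebra k C D, ∀ (n : ℕ) (_ : Coalgebra k (Vec k n))
      (_ : IsCocomm k (Vec k n)) (j : Vec k n →ₗc[k] B) (y : Vec k n), j y = b →
      ι (stageOf j f) y = m := by
  obtain ⟨V, hV, hs, hb⟩ := exists_subcoalgebra_mem (k := k) b
  obtain ⟨n, _, _, j, -, hr⟩ := exists_vec_of_subcoalgebra V hV hs
  obtain ⟨y, hy⟩ := hr.ge hb
  refine ⟨ι (stageOf j f) y, fun n' _ _ j' y' hy' => ?_⟩
  obtain ⟨W, hW, hs, hle⟩ := exists_subcoalgebra_ge (k := k)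
    (LinearMap.range (j : Vec k n →ₗ[k] B) ⊔ LinearMap.range (j' : Vec k n' →ₗ[k] B))
    ((Module.Finite.iff_fg.1 inferInstance).sup (Module.Finite.iff_fg.1 inferInstance))
  obtain ⟨N, _, _, J, hJ, hr⟩ := exists_vec_of_subcoalgebra W hW hs
  obtain ⟨φ, hφ⟩ := exists_factor J hJ j fun z => hr.ge (hle (Submodule.mem_sup_left ⟨z, rfl⟩))
  obtain ⟨φ', hφ'⟩ := exists_factor J hJ j' fun z => hr.ge (hle (Submodule.mem_sup_right ⟨z, rfl⟩))
  rw [← ι_stageOf_comp f J j φ hφ, ← ι_stageOf_comp f J j' φ' hφ']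
  congr 1
  apply hJ
  have h1 := congr($hφ y)
  have h2 := congr($hφ' y')
  simp only [CoalgHom.comp_apply] at h1 h2
  rw [h1, h2, hy']
  exact hy.symm

/-- Any two elements come from one finite-dimensional coalgebra. -/
lemma exists_vec_mem₂ (b b' : B) : ∃ (n : ℕ) (_ : Coalgebra k (Vec k n))
    (_ : IsCocomm k (Vec k n)) (j : Vec k n →ₗc[k] B) (y y' : Vec k n), j y = b ∧ j y' = b' := by
  obtain ⟨V, hV, hs, hb⟩ := exists_subcoalgebra_ge (k := k) (k ∙ b ⊔ k ∙ b')
    ((Submodule.fg_span_singleton _).sup (Submodule.fg_span_singleton _))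
  obtain ⟨n, _, _, j, -, hr⟩ := exists_vec_of_subcoalgebra V hV hs
  obtain ⟨y, hy⟩ := hr.ge (hb (Submodule.mem_sup_left (Submodule.mem_span_singleton_self b)))
  obtain ⟨y', hy'⟩ := hr.ge (hb (Submodule.mem_sup_right (Submodule.mem_span_singleton_self b')))
  exact ⟨n, _, ‹_›, j, y, y', hy, hy'⟩

/-- The underlying map of `lift`. -/
def liftFun (f : B ⊗[k] C →ₗc[k] D) (b : B) : MeasuringCoalgebra k C D :=
  (exists_lift_apply f b).choose

lemma liftFun_apply (f : B ⊗[k] C →ₗc[k] D) {n : ℕ} [Coalgebra k (Vec k n)]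
    [IsCocomm k (Vec k n)] (j : Vec k n →ₗc[k] B) (y : Vec k n) :
    liftFun f (j y) = ι (stageOf j f) y :=
  ((exists_lift_apply f (j y)).choose_spec n _ ‹_› j y rfl).symm

/-- The morphism `B → D ^ C` corresponding to a morphism `B ⊗ C → D`, for every cocommutative
coalgebra `B`. -/
def lift (f : B ⊗[k] C →ₗc[k] D) : B →ₗc[k] MeasuringCoalgebra k C D where
  toFun := liftFun f
  map_add' b b' := by
    obtain ⟨n, _, _, j, y, y', rfl, rfl⟩ := exists_vec_mem₂ (k := k) b b'
    rw [← map_add, liftFun_apply, liftFun_apply, liftFun_apply, map_add]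
  map_smul' r b := by
    obtain ⟨n, _, _, j, y, y', rfl, -⟩ := exists_vec_mem₂ (k := k) b b
    rw [← map_smul, liftFun_apply, liftFun_apply, map_smul, RingHom.id_apply]
  counit_comp := by
    ext b
    obtain ⟨n, _, _, j, y, y', rfl, -⟩ := exists_vec_mem₂ (k := k) b b
    simp [liftFun_apply]
  map_comp_comul := by
    ext1 b
    obtain ⟨n, _, _, j, y, y', rfl, -⟩ := exists_vec_mem₂ (k := k) b b
    simp only [LinearMap.comp_apply, LinearMap.coe_mk, AddHom.coe_mk, liftFun_apply,
      ← CoalgHomClass.map_comp_comul_apply, TensorProduct.map_map]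
    congr 2 <;> exact LinearMap.ext fun z => liftFun_apply f j z

lemma lift_apply (f : B ⊗[k] C →ₗc[k] D) {n : ℕ} [Coalgebra k (Vec k n)]
    [IsCocomm k (Vec k n)] (j : Vec k n →ₗc[k] B) (y : Vec k n) :
    lift f (j y) = ι (stageOf j f) y := liftFun_apply f j y

@[simp] lemma ev_lift (f : B ⊗[k] C →ₗc[k] D) (b : B) (c : C) :
    ev (lift f b ⊗ₜ c) = f (b ⊗ₜ c) := by
  obtain ⟨n, _, _, j, y, y', rfl, -⟩ := exists_vec_mem₂ (k := k) b b
  rw [lift_apply, ev_ι]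
  rfl

/-- Every element of `D ^ C` is determined by its position in a large enough finite-dimensional
subcoalgebra. -/
lemma exists_ι_stageOf (m : MeasuringCoalgebra k C D) :
    ∃ W : Submodule k (MeasuringCoalgebra k C D), W.FG ∧ m ∈ W ∧
      ∀ (n : ℕ) (_ : Coalgebra k (Vec k n)) (_ : IsCocomm k (Vec k n))
        (j : Vec k n →ₗc[k] MeasuringCoalgebra k C D), Function.Injective j →
        W ≤ LinearMap.range (j : Vec k n →ₗ[k] MeasuringCoalgebra k C D) →
        ∀ y, j y = m → ι (stageOf j ev) y = m := by
  induction m using induction_on with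
  | hz =>
    refine ⟨⊥, Submodule.fg_bot, zero_mem _, fun n _ _ j hj _ y hy => ?_⟩
    rw [← map_zero j] at hy
    rw [hj hy, map_zero]
  | hι s z =>
    refine ⟨LinearMap.range (ι s : Vec k s.n →ₗ[k] MeasuringCoalgebra k C D),
      Module.Finite.iff_fg.1 inferInstance, ⟨z, rfl⟩, fun n _ _ j hj hle y hy => ?_⟩
    obtain ⟨φ, hφ⟩ := exists_factor j hj (ι s) fun z => hle ⟨z, rfl⟩
    have h1 : y = φ z := hj (hy.trans congr($hφ z).symm)
    rw [h1]
    refine ι_apply_map (s := s) (t := stageOf j ev) φ ?_ z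
    apply CoalgHom.coe_linearMap_injective
    apply TensorProduct.ext'
    intro z c
    change ev (j (φ z) ⊗ₜ c) = s.f (z ⊗ₜ c)
    have h2 : j (φ z) = ι s z := congr($hφ z)
    rw [h2, ev_ι]
  | hadd m m' ih ih' =>
    obtain ⟨W, hW, hm, h⟩ := ih
    obtain ⟨W', hW', hm', h'⟩ := ih'
    refine ⟨W ⊔ W', hW.sup hW', add_mem (Submodule.mem_sup_left hm) (Submodule.mem_sup_right hm'),
      fun n _ _ j hj hle y hy => ?_⟩
    obtain ⟨z, hz⟩ := hle (Submodule.mem_sup_left hm)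
    obtain ⟨z', hz'⟩ := hle (Submodule.mem_sup_right hm')
    have h1 : y = z + z' := hj (by rw [map_add, hy]; exact (congrArg₂ _ hz hz').symm)
    rw [h1, map_add, h n _ ‹_› j hj (le_sup_left.trans hle) z hz,
      h' n _ ‹_› j hj (le_sup_right.trans hle) z' hz']

/-- A morphism to `D ^ C` is determined by its evaluations. -/
lemma hom_ext {g g' : B →ₗc[k] MeasuringCoalgebra k C D}
    (h : ∀ b c, ev (g b ⊗ₜ c) = ev (g' b ⊗ₜ c)) : g = g' := by
  suffices H : ∀ g : B →ₗc[k] MeasuringCoalgebra k C D, g = lift (ev.comp (g.rTensor C)) by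
    rw [H g, H g']
    congr 1
    apply CoalgHom.coe_linearMap_injective
    apply TensorProduct.ext'
    exact h
  intro g
  ext b
  obtain ⟨n, _, _, j, y, y', rfl, -⟩ := exists_vec_mem₂ (k := k) b b
  rw [lift_apply]
  obtain ⟨W, hW, -, hW'⟩ := exists_ι_stageOf (g (j y))
  obtain ⟨V, hV, hs, hle⟩ := exists_subcoalgebra_ge (k := k)
    (W ⊔ LinearMap.range ((g.comp j : Vec k n →ₗc[k] _) : Vec k n →ₗ[k] _))
    (hW.sup (Module.Finite.iff_fg.1 inferInstance))
  obtain ⟨N, _, _, J, hJ, hr⟩ := exists_vec_of_subcoalgebra V hV hs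
  obtain ⟨φ, hφ⟩ := exists_factor J hJ (g.comp j)
    fun z => hr.ge (hle (Submodule.mem_sup_right ⟨z, rfl⟩))
  have h1 : ∀ z, J (φ z) = g (j z) := fun z => congr($hφ z)
  have h2 := hW' N _ ‹_› J hJ ((le_sup_left.trans hle).trans hr.ge) (φ y) (h1 y)
  rw [← h2]
  refine ι_apply_map (s := stageOf j (ev.comp (g.rTensor C))) (t := stageOf J ev) φ ?_ y
  apply CoalgHom.coe_linearMap_injective
  apply TensorProduct.ext'
  intro z c
  change ev (J (φ z) ⊗ₜ c) = ev (g (j z) ⊗ₜ c)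
  rw [h1]

end Lift

end MeasuringCoalgebra
end Measuring

/-! ### Hopf algebra structure on the measuring coalgebra -/

section CoalgebraMaps

variable {k : Type u} [Field k]

/-- The exchange of the two middle factors, as a coalgebra morphism. -/
def exchange (k : Type u) [Field k] (A B C D : Type*) [AddCommGroup A] [Module k A]
    [Coalgebra k A] [AddCommGroup B] [Module k B] [Coalgebra k B] [AddCommGroup C] [Module k C]
    [Coalgebra k C] [AddCommGroup D] [Module k D] [Coalgebra k D] :
    (A ⊗[k] B) ⊗[k] (C ⊗[k] D) →ₗc[k] (A ⊗[k] C) ⊗[k] (B ⊗[k] D) where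
  toLinearMap := (TensorProduct.tensorTensorTensorComm k A B C D).toLinearMap
  counit_comp := by
    ext a b c d
    simp
    ring
  map_comp_comul := by
    ext a b c d
    simp [← (ℛ k a).eq, ← (ℛ k b).eq, ← (ℛ k c).eq, ← (ℛ k d).eq, TensorProduct.sum_tmul,
      TensorProduct.tmul_sum]
    exact Finset.sum_congr rfl fun _ _ => Finset.sum_comm

@[simp] lemma exchange_tmul {A B C D : Type*} [AddCommGroup A] [Module k A]
    [Coalgebra k A] [AddCommGroup B] [Module k B] [Coalgebra k B] [AddCommGroup C] [Module k C]
    [Coalgebra k C] [AddCommGroup D] [Module k D] [Coalgebra k D] (a : A) (b : B) (c : C) (d : D) :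
    exchange k A B C D ((a ⊗ₜ b) ⊗ₜ (c ⊗ₜ d)) = (a ⊗ₜ c) ⊗ₜ (b ⊗ₜ d) := rfl

open WithConv in
lemma comul_comp_antipode (H : Type*) [Ring H] [HopfAlgebra k H] [IsCocomm k H] :
    (comul (R := k) (A := H)) ∘ₗ HopfAlgebra.antipode k =
      TensorProduct.map (HopfAlgebra.antipode k) (HopfAlgebra.antipode k) ∘ₗ comul := by
  have h1 := LinearMap.comul_right_inv (R := k) (C := H)
  have h2 : toConv (TensorProduct.map (HopfAlgebra.antipode k) (HopfAlgebra.antipode k) ∘ₗ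
      (comul (R := k) (A := H))) * toConv (comul (R := k) (A := H)) = 1 := by
    have h3 := TensorProduct.map_convMul_map (R := k)
      (f := toConv (HopfAlgebra.antipode k (A := H))) (h := toConv LinearMap.id)
      (g := toConv (HopfAlgebra.antipode k (A := H))) (k := toConv LinearMap.id)
    rw [LinearMap.antipode_mul_id] at h3
    have h4 := LinearMap.convMul_comp_coalgHom_distrib
      (toConv (TensorProduct.map (HopfAlgebra.antipode k (A := H)) (HopfAlgebra.antipode k (A := H))))
      (toConv (TensorProduct.map (LinearMap.id : H →ₗ[k] H) (LinearMap.id : H →ₗ[k] H)))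
      (comulCoalgHom k H)
    have h5 := congrArg (fun z => z.ofConv ∘ₗ (comulCoalgHom k H).toLinearMap) h3
    apply WithConv.ofConv_injective
    refine Eq.trans ?_ (h4.symm.trans (h5.trans ?_))
    · rw [TensorProduct.map_id]; rfl
    · ext x
      have h6 := CoalgHomClass.counit_comp_apply (R := k) (comulCoalgHom k H) x
      refine Eq.trans ?_ (congrArg (algebraMap k (H ⊗[k] H)) h6)
      change TensorProduct.map (1 : WithConv (H →ₗ[k] H)).ofConv (1 : WithConv (H →ₗ[k] H)).ofConv
        (comulCoalgHom k H x) = _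
      induction comulCoalgHom k H x with
      | zero => simp
      | add y z hy hz => simp only [map_add, hy, hz]
      | tmul y z => simp [LinearMap.convOne_def, Algebra.TensorProduct.one_def,
          Algebra.algebraMap_eq_smul_one, TensorProduct.smul_tmul', TensorProduct.tmul_smul,
          smul_smul, mul_comm]
  have := left_inv_eq_right_inv h2 h1
  exact (congrArg WithConv.ofConv this).symm

/-- The antipode of a cocommutative Hopf algebra, as a coalgebra morphism. -/
def antipodeCoalgHom (k : Type u) [Field k] (H : Type*) [Ring H] [HopfAlgebra k H]
    [IsCocomm k H] : H →ₗc[k] H where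
  toLinearMap := HopfAlgebra.antipode k
  counit_comp := HopfAlgebra.counit_comp_antipode
  map_comp_comul := (comul_comp_antipode H).symm

end CoalgebraMaps

namespace MeasuringCoalgebra

section HopfStructure

variable {k : Type u} [Field k] {C : Type v} {D : Type w} [AddCommGroup C] [Module k C]
  [Coalgebra k C] [IsCocomm k C] [Ring D]

section Bialgebra

variable [Bialgebra k D]

open WithConv

lemma hom_ext' {B : Type*} [AddCommGroup B] [Module k B] [Coalgebra k B] [IsCocomm k B]
    {g g' : B →ₗc[k] MeasuringCoalgebra k C D}
    (h : evLinear ∘ₗ (g : B →ₗ[k] MeasuringCoalgebra k C D) =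
      evLinear ∘ₗ (g' : B →ₗ[k] MeasuringCoalgebra k C D)) : g = g' :=
  hom_ext fun b c => congr($h b c)

variable (k C D) in
/-- The morphism `(D ^ C ⊗ D ^ C) ⊗ C → D`, `(u ⊗ v) ⊗ c ↦ ∑ (u @ c₁) * (v @ c₂)`. -/
def mulEv : (MeasuringCoalgebra k C D ⊗[k] MeasuringCoalgebra k C D) ⊗[k] C →ₗc[k] D :=
  (Bialgebra.mulCoalgHom k D).comp <| (Coalgebra.TensorProduct.map
    (ev : MeasuringCoalgebra k C D ⊗[k] C →ₗc[k] D)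
    (ev : MeasuringCoalgebra k C D ⊗[k] C →ₗc[k] D)).comp <|
    (exchange k (MeasuringCoalgebra k C D) (MeasuringCoalgebra k C D) C C).comp <|
    CoalgHom.lTensor (MeasuringCoalgebra k C D ⊗[k] MeasuringCoalgebra k C D) (comulCoalgHom k C)

variable (k C D) in
/-- The multiplication `D ^ C ⊗ D ^ C → D ^ C`, which is determined by
`(u * v) @ c = ∑ (u @ c₁) * (v @ c₂)`. -/
def mulHom : MeasuringCoalgebra k C D ⊗[k] MeasuringCoalgebra k C D →ₗc[k]
    MeasuringCoalgebra k C D :=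
  lift (mulEv k C D)

variable (k C D) in
/-- The unit `k → D ^ C`, which is determined by `1 @ c = ε(c) 1`. -/
def oneHom : k →ₗc[k] MeasuringCoalgebra k C D :=
  lift <| (Bialgebra.unitBialgHom k D : k →ₗc[k] D).comp <| (counitCoalgHom k C).comp
    (Coalgebra.TensorProduct.lid k C : k ⊗[k] C →ₗc[k] C)

instance : Mul (MeasuringCoalgebra k C D) := ⟨fun m m' => mulHom k C D (m ⊗ₜ m')⟩

instance : One (MeasuringCoalgebra k C D) := ⟨oneHom k C D 1⟩

lemma mul_def (m m' : MeasuringCoalgebra k C D) : m * m' = mulHom k C D (m ⊗ₜ m') := rfl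

lemma one_def : (1 : MeasuringCoalgebra k C D) = oneHom k C D 1 := rfl

lemma evLinear_mul (m m' : MeasuringCoalgebra k C D) :
    evLinear (m * m') = (toConv (evLinear m) * toConv (evLinear m')).ofConv := by
  ext c
  refine (ev_lift _ (m ⊗ₜ m') c).trans ?_
  change Bialgebra.mulCoalgHom k D (Coalgebra.TensorProduct.map ev ev (exchange k _ _ _ _
    ((m ⊗ₜ m') ⊗ₜ comul c))) = LinearMap.mul' k D (TensorProduct.map _ _ (comul c))
  induction comul (R := k) c with
  | zero => simp
  | add y z hy hz => simp only [TensorProduct.tmul_add, map_add, hy, hz]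
  | tmul y z => rfl

lemma evLinear_oneHom (r : k) :
    evLinear (oneHom k C D r) = (r • (1 : WithConv (C →ₗ[k] D))).ofConv := by
  ext c
  refine (ev_lift _ r c).trans ?_
  change algebraMap k D (counit (R := k) (r • c)) = r • algebraMap k D (counit c)
  rw [map_smul, smul_eq_mul, map_mul, ← Algebra.smul_def]

lemma evLinear_one :
    evLinear (1 : MeasuringCoalgebra k C D) = (1 : WithConv (C →ₗ[k] D)).ofConv := by
  rw [one_def, evLinear_oneHom, one_smul]

instance : Ring (MeasuringCoalgebra k C D) where
  __ := (inferInstance : AddCommGroup (MeasuringCoalgebra k C D))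
  left_distrib a b c := by simp only [mul_def, TensorProduct.tmul_add, map_add]
  right_distrib a b c := by simp only [mul_def, TensorProduct.add_tmul, map_add]
  zero_mul a := by simp only [mul_def, TensorProduct.zero_tmul, map_zero]
  mul_zero a := by simp only [mul_def, TensorProduct.tmul_zero, map_zero]
  mul_assoc a b c := by
    have h : (mulHom k C D).comp ((mulHom k C D).rTensor _) =
        (mulHom k C D).comp (((mulHom k C D).lTensor _).comp
          (Coalgebra.TensorProduct.assoc k k (MeasuringCoalgebra k C D)
            (MeasuringCoalgebra k C D) (MeasuringCoalgebra k C D)).toCoalgHom) := by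
      apply hom_ext'
      ext a b c : 5
      change evLinear (a * b * c) = evLinear (a * (b * c))
      simp only [evLinear_mul, toConv_ofConv, mul_assoc]
    exact congr($h ((a ⊗ₜ b) ⊗ₜ c))
  one_mul a := by
    have h : (mulHom k C D).comp (((oneHom k C D).rTensor _).comp
        (Coalgebra.TensorProduct.lid k (MeasuringCoalgebra k C D)).symm.toCoalgHom) = CoalgHom.id k _ := by
      apply hom_ext'
      ext a : 1
      change evLinear (1 * a) = evLinear a
      simp only [evLinear_mul, evLinear_one, toConv_ofConv, one_mul, ofConv_toConv]
    exact congr($h a)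
  mul_one a := by
    have h : (mulHom k C D).comp (((oneHom k C D).lTensor _).comp
        (Coalgebra.TensorProduct.rid k k (MeasuringCoalgebra k C D)).symm.toCoalgHom) = CoalgHom.id k _ := by
      apply hom_ext'
      ext a : 1
      change evLinear (a * 1) = evLinear a
      simp only [evLinear_mul, evLinear_one, toConv_ofConv, mul_one, ofConv_toConv]
    exact congr($h a)

instance : Algebra k (MeasuringCoalgebra k C D) :=
  Algebra.ofModule
    (fun r a b => by simp only [mul_def, ← TensorProduct.smul_tmul', map_smul])
    (fun r a b => by simp only [mul_def, TensorProduct.tmul_smul, map_smul])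

lemma toLinearMap_mulHom :
    (mulHom k C D : _ →ₗ[k] MeasuringCoalgebra k C D) = LinearMap.mul' k _ := by
  ext a b
  rfl

instance : Bialgebra k (MeasuringCoalgebra k C D) :=
  Bialgebra.mk' k _
    (by
      rw [one_def]
      exact CoalgHomClass.counit_comp_apply (oneHom k C D) 1)
    (by
      intro a b
      rw [mul_def]
      refine (CoalgHomClass.counit_comp_apply (mulHom k C D) (a ⊗ₜ b)).trans ?_
      simp [mul_comm])
    (by
      rw [one_def]
      exact (CoalgHomClass.map_comp_comul_apply (oneHom k C D) 1).symm)
    (by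
      intro a b
      rw [mul_def]
      refine (CoalgHomClass.map_comp_comul_apply (mulHom k C D) (a ⊗ₜ b)).symm.trans ?_
      rw [toLinearMap_mulHom, ← (ℛ k a).eq, ← (ℛ k b).eq]
      simp [← (ℛ k a).eq, ← (ℛ k b).eq, TensorProduct.sum_tmul, TensorProduct.tmul_sum,
        Finset.sum_mul_sum]
      exact Finset.sum_comm)

lemma algebraMap_eq (r : k) : algebraMap k (MeasuringCoalgebra k C D) r = oneHom k C D r := by
  rw [Algebra.algebraMap_eq_smul_one, one_def, ← map_smul, smul_eq_mul, mul_one]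

lemma evLinear_algebraMap (r : k) (c : C) :
    evLinear (algebraMap k (MeasuringCoalgebra k C D) r) c = algebraMap k D (r * counit c) := by
  rw [algebraMap_eq, evLinear_oneHom, map_mul, ← Algebra.smul_def]
  rfl

end Bialgebra

variable [HopfAlgebra k D] [IsCocomm k D]

open WithConv

variable (k C D) in
/-- The antipode `D ^ C → D ^ C`, which is determined by `S(u) @ c = S(u @ c)`. -/
def antipodeHom : MeasuringCoalgebra k C D →ₗc[k] MeasuringCoalgebra k C D :=
  lift ((antipodeCoalgHom k D).comp ev)

lemma evLinear_antipodeHom (m : MeasuringCoalgebra k C D) :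
    evLinear (antipodeHom k C D m) = HopfAlgebra.antipode k ∘ₗ evLinear m := by
  ext c
  exact ev_lift _ m c

lemma evLinear_mul_antipode_rTensor (m : MeasuringCoalgebra k C D) :
    evLinear (LinearMap.mul' k (MeasuringCoalgebra k C D)
      ((antipodeHom k C D : _ →ₗ[k] MeasuringCoalgebra k C D).rTensor
        (MeasuringCoalgebra k C D) (comul m))) =
      evLinear (algebraMap k (MeasuringCoalgebra k C D) (counit m)) := by
  ext c
  have h1 := CoalgHomClass.map_comp_comul_apply (R := k)
    (ev (k := k) (C := C) (D := D)) (m ⊗ₜ c)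
  have h2 := HopfAlgebra.mul_antipode_rTensor_comul_apply (R := k)
    (ev (k := k) (C := C) (D := D) (m ⊗ₜ c))
  rw [CoalgHomClass.counit_comp_apply, ← h1] at h2
  rw [evLinear_algebraMap]
  refine Eq.trans ?_ (h2.trans ?_)
  · rw [TensorProduct.comul_tmul]
    induction comul (R := k) m with
    | zero => simp
    | add y z hy hz => simp only [map_add, TensorProduct.add_tmul, LinearMap.add_apply, hy, hz]
    | tmul y z =>
      simp only [LinearMap.rTensor_tmul, LinearMap.mul'_apply, CoalgHom.coe_toLinearMap,
        evLinear_mul, evLinear_antipodeHom]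
      change LinearMap.mul' k D (TensorProduct.map _ _ (comul c)) = _
      induction comul (R := k) c with
      | zero => simp
      | add a b ha hb => simp only [TensorProduct.tmul_add, map_add, ha, hb]
      | tmul a b => rfl
  · simp [mul_comm]

lemma evLinear_mul_antipode_lTensor (m : MeasuringCoalgebra k C D) :
    evLinear (LinearMap.mul' k (MeasuringCoalgebra k C D)
      ((antipodeHom k C D : _ →ₗ[k] MeasuringCoalgebra k C D).lTensor
        (MeasuringCoalgebra k C D) (comul m))) =
      evLinear (algebraMap k (MeasuringCoalgebra k C D) (counit m)) := by
  ext c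
  have h1 := CoalgHomClass.map_comp_comul_apply (R := k)
    (ev (k := k) (C := C) (D := D)) (m ⊗ₜ c)
  have h2 := HopfAlgebra.mul_antipode_lTensor_comul_apply (R := k)
    (ev (k := k) (C := C) (D := D) (m ⊗ₜ c))
  rw [CoalgHomClass.counit_comp_apply, ← h1] at h2
  rw [evLinear_algebraMap]
  refine Eq.trans ?_ (h2.trans ?_)
  · rw [TensorProduct.comul_tmul]
    induction comul (R := k) m with
    | zero => simp
    | add y z hy hz => simp only [map_add, TensorProduct.add_tmul, LinearMap.add_apply, hy, hz]
    | tmul y z =>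
      simp only [LinearMap.lTensor_tmul, LinearMap.mul'_apply, CoalgHom.coe_toLinearMap,
        evLinear_mul, evLinear_antipodeHom]
      change LinearMap.mul' k D (TensorProduct.map _ _ (comul c)) = _
      induction comul (R := k) c with
      | zero => simp
      | add a b ha hb => simp only [TensorProduct.tmul_add, map_add, ha, hb]
      | tmul a b => rfl
  · simp [mul_comm]

instance : HopfAlgebra k (MeasuringCoalgebra k C D) where
  antipode := antipodeHom k C D
  mul_antipode_rTensor_comul := by
    have h : (mulHom k C D).comp (((antipodeHom k C D).rTensor (MeasuringCoalgebra k C D)).comp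
        (comulCoalgHom k (MeasuringCoalgebra k C D))) =
        (oneHom k C D).comp (counitCoalgHom k (MeasuringCoalgebra k C D)) := by
      apply hom_ext'
      ext1 m
      refine Eq.trans ?_ ((evLinear_mul_antipode_rTensor m).trans ?_)
      · rw [← toLinearMap_mulHom]
        rfl
      · rw [algebraMap_eq]
        rfl
    ext m
    refine Eq.trans ?_ (congr($h m).trans ?_)
    · rw [← toLinearMap_mulHom]
      rfl
    · exact (algebraMap_eq _).symm
  mul_antipode_lTensor_comul := by
    have h : (mulHom k C D).comp (((antipodeHom k C D).lTensor (MeasuringCoalgebra k C D)).comp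
        (comulCoalgHom k (MeasuringCoalgebra k C D))) =
        (oneHom k C D).comp (counitCoalgHom k (MeasuringCoalgebra k C D)) := by
      apply hom_ext'
      ext1 m
      refine Eq.trans ?_ ((evLinear_mul_antipode_lTensor m).trans ?_)
      · rw [← toLinearMap_mulHom]
        rfl
      · rw [algebraMap_eq]
        rfl
    ext m
    refine Eq.trans ?_ (congr($h m).trans ?_)
    · rw [← toLinearMap_mulHom]
      rfl
    · exact (algebraMap_eq _).symm

end HopfStructure
end MeasuringCoalgebra

/-! ### Smash products -/

section Smash

variable {k : Type u} [Field k]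

/-- The exchange of two tensor factors, as a coalgebra morphism. -/
def swap (k : Type u) [Field k] (A B : Type*) [AddCommGroup A] [Module k A]
    [Coalgebra k A] [AddCommGroup B] [Module k B] [Coalgebra k B] : A ⊗[k] B →ₗc[k] B ⊗[k] A where
  toLinearMap := (TensorProduct.comm k A B).toLinearMap
  counit_comp := by
    ext a b
    simp [mul_comm]
  map_comp_comul := by
    ext a b
    simp [← (ℛ k a).eq, ← (ℛ k b).eq, TensorProduct.sum_tmul, TensorProduct.tmul_sum]
    exact Finset.sum_comm

/-- A Hopf module structure of `Q` on `H`: a coalgebra morphism `⋆ : Q ⊗ H → H` which is an action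
of the algebra `Q` on `H` and satisfies `q ⋆ 1 = ε(q) 1`, `q ⋆ (h h') = ∑ (q₁ ⋆ h) (q₂ ⋆ h')`. -/
structure HopfAction (k : Type u) [Field k] (Q : Type v) (H : Type w) [Ring Q] [Bialgebra k Q]
    [Ring H] [Bialgebra k H] where
  /-- the action -/
  star : Q ⊗[k] H →ₗc[k] H
  star_one : ∀ q : Q, star (q ⊗ₜ 1) = algebraMap k H (counit q)
  star_mul : ∀ (q : Q) (h h' : H), star (q ⊗ₜ (h * h')) =
    LinearMap.mul' k H (TensorProduct.map ((TensorProduct.curry (star : _ →ₗ[k] H)).flip h)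
      ((TensorProduct.curry (star : _ →ₗ[k] H)).flip h') (comul q))
  one_star : ∀ h : H, star (1 ⊗ₜ h) = h
  star_star : ∀ (q r : Q) (h : H), star (q ⊗ₜ star (r ⊗ₜ h)) = star ((q * r) ⊗ₜ h)

variable {Q : Type v} {H : Type w} [Ring Q] [Ring H]

section

variable [Bialgebra k Q] [Bialgebra k H]

lemma HopfAction.star_mul_sum (a : HopfAction k Q H) (q : Q) (h h' : H) :
    a.star (q ⊗ₜ (h * h')) = ∑ i ∈ (ℛ k q).index,
      a.star ((ℛ k q).left i ⊗ₜ h) * a.star ((ℛ k q).right i ⊗ₜ h') := by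
  rw [a.star_mul]
  conv_lhs => rw [← (ℛ k q).eq]
  simp

/-- The smash product `H # Q`; as a coalgebra, this is `H ⊗ Q`. -/
def Smash (_a : HopfAction k Q H) : Type (max w v) := H ⊗[k] Q

namespace Smash

variable (a : HopfAction k Q H)

instance : AddCommGroup (Smash a) := inferInstanceAs (AddCommGroup (H ⊗[k] Q))
instance : Module k (Smash a) := inferInstanceAs (Module k (H ⊗[k] Q))
instance : Coalgebra k (Smash a) := inferInstanceAs (Coalgebra k (H ⊗[k] Q))
instance [IsCocomm k H] [IsCocomm k Q] : IsCocomm k (Smash a) :=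
  inferInstanceAs (IsCocomm k (H ⊗[k] Q))

/-- The element `h # q`. -/
def tmul (h : H) (q : Q) : Smash a := h ⊗ₜ[k] q

lemma induction_on {p : Smash a → Prop} (x : Smash a) (hz : p 0)
    (ht : ∀ h q, p (tmul a h q)) (hadd : ∀ x y, p x → p y → p (x + y)) : p x :=
  TensorProduct.induction_on (motive := p) x hz ht hadd

/-- The map `h' # q ↦ h h' # q`. -/
def mulL (h : H) : Smash a →ₗ[k] Smash a := (LinearMap.mulLeft k h).rTensor Q

@[simp] lemma mulL_tmul (h h' : H) (q : Q) : mulL a h (tmul a h' q) = tmul a (h * h') q := rfl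

lemma mulL_one (x : Smash a) : mulL a 1 x = x := by
  induction x using induction_on with
  | hz => rw [map_zero]
  | hadd x y hx hy => rw [map_add, hx, hy]
  | ht h q => rw [mulL_tmul, one_mul]

lemma mulL_mul (h h' : H) (x : Smash a) : mulL a (h * h') x = mulL a h (mulL a h' x) := by
  induction x using induction_on with
  | hz => simp only [map_zero]
  | hadd x y hx hy => simp only [map_add, hx, hy]
  | ht h q => simp only [mulL_tmul, mul_assoc]

variable [IsCocomm k Q]

/-- The morphism `Q ⊗ (H # Q) → H # Q`, `q ⊗ (h # r) ↦ ∑ (q₁ ⋆ h) # q₂ r`. -/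
def twist : Q ⊗[k] Smash a →ₗc[k] Smash a :=
  ((Coalgebra.TensorProduct.map a.star (Bialgebra.mulCoalgHom k Q)).comp <|
    (exchange k Q Q H Q).comp <| CoalgHom.rTensor (H ⊗[k] Q) (comulCoalgHom k Q) :
    Q ⊗[k] (H ⊗[k] Q) →ₗc[k] H ⊗[k] Q)

/-- The morphism `(H # Q) ⊗ (H # Q) → H # Q`, `(h # q) ⊗ (h' # r) ↦ ∑ h (q₁ ⋆ h') # q₂ r`. -/
def mulHom : Smash a ⊗[k] Smash a →ₗc[k] Smash a :=
  ((CoalgHom.rTensor Q (Bialgebra.mulCoalgHom k H)).comp <|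
    (Coalgebra.TensorProduct.assoc k k H H Q).symm.toCoalgHom.comp <|
    (CoalgHom.lTensor H (twist a : Q ⊗[k] (H ⊗[k] Q) →ₗc[k] H ⊗[k] Q)).comp
    (Coalgebra.TensorProduct.assoc k k H Q (H ⊗[k] Q)).toCoalgHom :
    (H ⊗[k] Q) ⊗[k] (H ⊗[k] Q) →ₗc[k] H ⊗[k] Q)

instance : Mul (Smash a) := ⟨fun x y => mulHom a (x ⊗ₜ[k] y)⟩

instance : One (Smash a) := ⟨tmul a 1 1⟩

lemma one_def : (1 : Smash a) = tmul a 1 1 := rfl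

lemma mul_def (x y : Smash a) : x * y = mulHom a (x ⊗ₜ[k] y) := rfl

lemma tmul_mul (h : H) (q : Q) (x : Smash a) :
    tmul a h q * x = mulL a h (twist a (q ⊗ₜ[k] x)) := by
  have key : ∀ y : H ⊗[k] Q, CoalgHom.rTensor Q (Bialgebra.mulCoalgHom k H)
      ((Coalgebra.TensorProduct.assoc k k H H Q).symm (h ⊗ₜ y)) =
      (LinearMap.mulLeft k h).rTensor Q y := by
    intro y
    induction y with
    | zero => simp
    | add y z hy hz => simp only [TensorProduct.tmul_add, map_add, hy, hz]
    | tmul y z => rfl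
  exact key _

lemma twist_tmul (q : Q) (h : H) (r : Q) : twist a (q ⊗ₜ tmul a h r) =
    ∑ i ∈ (ℛ k q).index, tmul a (a.star ((ℛ k q).left i ⊗ₜ h)) ((ℛ k q).right i * r) := by
  change Coalgebra.TensorProduct.map a.star (Bialgebra.mulCoalgHom k Q)
    (exchange k Q Q H Q (comul q ⊗ₜ (h ⊗ₜ r))) = _
  conv_lhs => rw [← (ℛ k q).eq]
  rw [TensorProduct.sum_tmul, map_sum, map_sum]
  rfl

/-- The product of two elementary tensors. -/
lemma tmul_mul_tmul (h h' : H) (q r : Q) : tmul a h q * tmul a h' r =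
    ∑ i ∈ (ℛ k q).index,
      tmul a (h * a.star ((ℛ k q).left i ⊗ₜ h')) ((ℛ k q).right i * r) := by
  rw [tmul_mul, twist_tmul, map_sum]
  rfl

lemma twist_one (x : Smash a) : twist a (1 ⊗ₜ x) = x := by
  induction x using induction_on with
  | hz => simp
  | hadd y z hy hz => simp only [TensorProduct.tmul_add, map_add, hy, hz]
  | ht h r =>
    change Coalgebra.TensorProduct.map a.star (Bialgebra.mulCoalgHom k Q)
      (exchange k Q Q H Q (comul (1 : Q) ⊗ₜ (h ⊗ₜ r))) = h ⊗ₜ r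
    simp [Algebra.TensorProduct.one_def, a.one_star]

lemma twist_mul (q r : Q) (x : Smash a) :
    twist a ((q * r) ⊗ₜ x) = twist a (q ⊗ₜ twist a (r ⊗ₜ x)) := by
  induction x using induction_on with
  | hz => simp
  | hadd y z hy hz => simp only [TensorProduct.tmul_add, map_add, hy, hz]
  | ht h s =>
    rw [twist_tmul a r]
    simp only [TensorProduct.tmul_sum, map_sum, twist_tmul a q]
    change Coalgebra.TensorProduct.map a.star (Bialgebra.mulCoalgHom k Q)
      (exchange k Q Q H Q (comul (q * r) ⊗ₜ (h ⊗ₜ s))) = _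
    rw [Bialgebra.comul_mul]
    conv_lhs => rw [← (ℛ k q).eq, ← (ℛ k r).eq]
    simp only [Finset.sum_mul_sum, TensorProduct.sum_tmul, map_sum, a.star_star, mul_assoc,
      Algebra.TensorProduct.tmul_mul_tmul, exchange_tmul, Coalgebra.TensorProduct.map_tmul,
      Bialgebra.coe_mulCoalgHom, LinearMap.mul'_apply]
    exact Finset.sum_comm

lemma twist_mulL (q : Q) (h : H) (x : Smash a) :
    twist a (q ⊗ₜ mulL a h x) = ∑ i ∈ (ℛ k q).index,
      mulL a (a.star ((ℛ k q).left i ⊗ₜ h)) (twist a ((ℛ k q).right i ⊗ₜ x)) := by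
  induction x using induction_on with
  | hz => simp
  | hadd y z hy hz => simp only [TensorProduct.tmul_add, map_add, hy, hz, Finset.sum_add_distrib]
  | ht h' s =>
    let st : Q →ₗ[k] H →ₗ[k] H := TensorProduct.curry (a.star : _ →ₗ[k] H)
    let Ψ : Q ⊗[k] (Q ⊗[k] Q) →ₗ[k] H ⊗[k] Q :=
      TensorProduct.map (LinearMap.mul' k H) LinearMap.id ∘ₗ
        (TensorProduct.assoc k H H Q).symm.toLinearMap ∘ₗ
        TensorProduct.map (st.flip h) (TensorProduct.map (st.flip h') (LinearMap.mulRight k s))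
    have h1 := congrArg Ψ (Coalgebra.coassoc_apply (R := k) q)
    conv_lhs at h1 => rw [← (ℛ k q).eq]
    conv_rhs at h1 => rw [← (ℛ k q).eq]
    simp only [map_sum, LinearMap.rTensor_tmul, LinearMap.lTensor_tmul] at h1
    rw [mulL_tmul, twist_tmul]
    refine Eq.trans ?_ (h1.trans ?_)
    · refine Finset.sum_congr rfl fun i _ => ?_
      rw [a.star_mul_sum]
      conv_rhs => rw [← (ℛ k ((ℛ k q).left i)).eq]
      simp [TensorProduct.sum_tmul, Ψ, st, tmul]
      rfl
    · refine Finset.sum_congr rfl fun i _ => ?_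
      rw [twist_tmul]
      conv_lhs => rw [← (ℛ k ((ℛ k q).right i)).eq]
      simp only [TensorProduct.tmul_sum, map_sum]
      rfl

lemma add_mul' (x y z : Smash a) : (x + y) * z = x * z + y * z := by
  simp only [mul_def, TensorProduct.add_tmul, map_add]

lemma mul_add' (x y z : Smash a) : x * (y + z) = x * y + x * z := by
  simp only [mul_def, TensorProduct.tmul_add, map_add]

lemma zero_mul' (x : Smash a) : 0 * x = 0 := by
  simp only [mul_def, TensorProduct.zero_tmul, map_zero]

lemma mul_zero' (x : Smash a) : x * 0 = 0 := by
  simp only [mul_def, TensorProduct.tmul_zero, map_zero]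

lemma sum_mul' {ι : Type*} (s : Finset ι) (f : ι → Smash a) (z : Smash a) :
    (∑ i ∈ s, f i) * z = ∑ i ∈ s, f i * z :=
  map_sum (⟨⟨fun x => x * z, zero_mul' a z⟩, fun x y => add_mul' a x y z⟩ : Smash a →+ Smash a) f s

instance : Ring (Smash a) where
  __ := (inferInstance : AddCommGroup (Smash a))
  left_distrib := mul_add' a
  right_distrib := add_mul' a
  zero_mul := zero_mul' a
  mul_zero := mul_zero' a
  one_mul x := by
    rw [one_def, tmul_mul, twist_one, mulL_one]
  mul_one x := by
    induction x using induction_on with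
    | hz => rw [zero_mul']
    | hadd x y hx hy => rw [add_mul', hx, hy]
    | ht h q =>
      rw [one_def, tmul_mul_tmul]
      simp only [a.star_one, mul_one]
      simp only [tmul, ← Algebra.commutes, ← Algebra.smul_def]
      have h1 := congrArg (fun t => h ⊗ₜ[k] t) (sum_counit_smul (ℛ k q))
      simp only [TensorProduct.tmul_sum, ← TensorProduct.smul_tmul] at h1
      exact h1
  mul_assoc x y z := by
    induction x using induction_on with
    | hz => rw [zero_mul', zero_mul', zero_mul']
    | hadd x x' hx hx' => rw [add_mul', add_mul', add_mul', hx, hx']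
    | ht h q =>
      induction y using induction_on with
      | hz => rw [zero_mul', mul_zero', zero_mul']
      | hadd y y' hy hy' => rw [add_mul', mul_add', mul_add', add_mul', hy, hy']
      | ht h' r =>
        rw [tmul_mul_tmul, sum_mul', tmul_mul a h' r z, tmul_mul a h q]
        refine Eq.trans ?_ (congrArg _ (twist_mulL a q h' _).symm)
        rw [map_sum]
        refine Finset.sum_congr rfl fun i _ => ?_
        rw [tmul_mul, mulL_mul, twist_mul]

instance : Algebra k (Smash a) :=
  Algebra.ofModule
    (fun r x y => by simp only [mul_def, ← TensorProduct.smul_tmul', map_smul])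
    (fun r x y => by simp only [mul_def, TensorProduct.tmul_smul, map_smul])

lemma toLinearMap_mulHom : (mulHom a : _ →ₗ[k] Smash a) = LinearMap.mul' k (Smash a) := by
  apply TensorProduct.ext'
  intro x y
  rfl

instance : Bialgebra k (Smash a) :=
  Bialgebra.mk' k _
    (by
      rw [one_def]
      change counit (R := k) ((1 : H) ⊗ₜ[k] (1 : Q)) = 1
      simp)
    (by
      intro x y
      rw [mul_def]
      refine (CoalgHomClass.counit_comp_apply (mulHom a) (x ⊗ₜ[k] y)).trans ?_
      simp [mul_comm])
    (by
      rw [one_def]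
      change comul (R := k) ((1 : H) ⊗ₜ[k] (1 : Q)) =
        ((1 : H) ⊗ₜ[k] (1 : Q)) ⊗ₜ[k] ((1 : H) ⊗ₜ[k] (1 : Q))
      simp [Algebra.TensorProduct.one_def])
    (by
      intro x y
      rw [mul_def]
      refine (CoalgHomClass.map_comp_comul_apply (mulHom a) (x ⊗ₜ[k] y)).symm.trans ?_
      rw [toLinearMap_mulHom, ← (ℛ k x).eq, ← (ℛ k y).eq]
      simp [← (ℛ k x).eq, ← (ℛ k y).eq, TensorProduct.sum_tmul, TensorProduct.tmul_sum,
        Finset.sum_mul_sum]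
      exact Finset.sum_comm)

lemma tmul_one_mul (h : H) (q : Q) : tmul a h 1 * tmul a 1 q = tmul a h q := by
  rw [tmul_mul, twist_one, mulL_tmul, mul_one]

lemma tmul_one_mul_tmul_one (h h' : H) : tmul a h 1 * tmul a h' 1 = tmul a (h * h') 1 := by
  rw [tmul_mul, twist_one, mulL_tmul]

lemma one_tmul_mul_one_tmul (q r : Q) : tmul a 1 q * tmul a 1 r = tmul a 1 (q * r) := by
  rw [tmul_mul_tmul]
  simp only [a.star_one, one_mul]
  have h1 := congrArg (fun t => (1 : H) ⊗ₜ[k] (t * r)) (sum_counit_smul (ℛ k q))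
  simp only [Finset.sum_mul, TensorProduct.tmul_sum, smul_mul_assoc,
    ← TensorProduct.smul_tmul] at h1
  refine Eq.trans (Finset.sum_congr rfl fun i _ => ?_) h1
  rw [Algebra.algebraMap_eq_smul_one]
  rfl

/-- The map `h ↦ h # 1`. -/
def inl : H →ₗ[k] Smash a := (TensorProduct.mk k H Q).flip 1

/-- The map `q ↦ 1 # q`. -/
def inr : Q →ₗ[k] Smash a := TensorProduct.mk k H Q 1

lemma inl_mul (h h' : H) : inl a h * inl a h' = inl a (h * h') := tmul_one_mul_tmul_one a h h'

lemma inr_mul (q q' : Q) : inr a q * inr a q' = inr a (q * q') := one_tmul_mul_one_tmul a q q'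

lemma inl_mul_inr (h : H) (q : Q) : inl a h * inr a q = tmul a h q := tmul_one_mul a h q

lemma inl_one : inl a 1 = 1 := rfl

lemma inr_one : inr a 1 = 1 := rfl

end Smash
end

namespace Smash

variable [HopfAlgebra k Q] [HopfAlgebra k H] (a : HopfAction k Q H) [IsCocomm k Q]

/-- The antipode of the smash product, `S(h # q) = (1 # S(q)) (S(h) # 1)`. For cocommutative `Q`
this is `∑ (S(q₁) ⋆ S(h)) # S(q₂)`. -/
def antipodeMap : Smash a →ₗ[k] Smash a :=
  (LinearMap.mul' k (Smash a) ∘ₗ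
    TensorProduct.map (inr a ∘ₗ HopfAlgebra.antipode k) (inl a ∘ₗ HopfAlgebra.antipode k) ∘ₗ
    (TensorProduct.comm k H Q).toLinearMap : H ⊗[k] Q →ₗ[k] Smash a)

lemma antipodeMap_tmul (h : H) (q : Q) : antipodeMap a (tmul a h q) =
    inr a (HopfAlgebra.antipode k q) * inl a (HopfAlgebra.antipode k h) := rfl

lemma antipodeMap_tmul_eq_sum (h : H) (q : Q) : antipodeMap a (tmul a h q) =
    ∑ i ∈ (ℛ k q).index, tmul a (a.star (HopfAlgebra.antipode k ((ℛ k q).left i) ⊗ₜ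
      HopfAlgebra.antipode k h)) (HopfAlgebra.antipode k ((ℛ k q).right i)) := by
  rw [antipodeMap_tmul]
  change tmul a 1 _ * tmul a _ 1 = _
  rw [tmul_mul, mulL_one]
  change Coalgebra.TensorProduct.map a.star (Bialgebra.mulCoalgHom k Q)
    (exchange k Q Q H Q (comul (HopfAlgebra.antipode k q) ⊗ₜ
      (HopfAlgebra.antipode k h ⊗ₜ (1 : Q)))) = _
  have h1 : comul (R := k) (HopfAlgebra.antipode k q) = _ := congr($(comul_comp_antipode Q) q)
  rw [h1, LinearMap.comp_apply]
  conv_lhs => rw [← (ℛ k q).eq]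
  simp [TensorProduct.sum_tmul]
  rfl

lemma comul_tmul (h : H) (q : Q) : comul (R := k) (tmul a h q) =
    ∑ i ∈ (ℛ k h).index, ∑ j ∈ (ℛ k q).index,
      tmul a ((ℛ k h).left i) ((ℛ k q).left j) ⊗ₜ[k]
        tmul a ((ℛ k h).right i) ((ℛ k q).right j) := by
  refine (TensorProduct.comul_tmul (R := k) (S := k) h q).trans ?_
  conv_lhs => rw [← (ℛ k h).eq, ← (ℛ k q).eq]
  simp [TensorProduct.sum_tmul, TensorProduct.tmul_sum]
  exact Finset.sum_comm

lemma counit_tmul (h : H) (q : Q) :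
    counit (R := k) (tmul a h q) = counit (R := k) h * counit (R := k) q :=
  (TensorProduct.counit_tmul (R := k) (S := k) h q).trans (mul_comm _ _)

instance : HopfAlgebra k (Smash a) where
  antipode := antipodeMap a
  mul_antipode_rTensor_comul := by
    ext x
    induction x using induction_on with
    | hz => simp only [map_zero]
    | hadd x y hx hy => rw [map_add, map_add, hx, hy]
    | ht h q =>
      simp only [LinearMap.comp_apply, comul_tmul, map_sum, LinearMap.rTensor_tmul,
        LinearMap.mul'_apply, antipodeMap_tmul, counit_tmul, Algebra.linearMap_apply]
      rw [Finset.sum_comm]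
      have h1 := HopfAlgebra.sum_antipode_mul_eq_smul (ℛ k h)
      have h2 := HopfAlgebra.sum_antipode_mul_eq_smul (ℛ k q)
      have h3 : ∀ j ∈ (ℛ k q).index, ∑ i ∈ (ℛ k h).index,
          inr a (HopfAlgebra.antipode k ((ℛ k q).left j)) *
            inl a (HopfAlgebra.antipode k ((ℛ k h).left i)) *
              tmul a ((ℛ k h).right i) ((ℛ k q).right j) =
          counit (R := k) h • inr a (HopfAlgebra.antipode k ((ℛ k q).left j) *
            (ℛ k q).right j) := by
        intro j _
        have h4 := congrArg (fun t => inr a (HopfAlgebra.antipode k ((ℛ k q).left j)) * inl a t *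
          inr a ((ℛ k q).right j)) h1
        simp only [map_sum, map_smul, Finset.mul_sum, Finset.sum_mul, inl_one, mul_smul_comm,
          smul_mul_assoc, mul_one, inr_mul] at h4
        rw [← h4]
        refine Finset.sum_congr rfl fun i _ => ?_
        rw [← inl_mul, ← inl_mul_inr]
        simp only [mul_assoc]
      rw [Finset.sum_congr rfl h3, ← Finset.smul_sum, ← map_sum, h2, map_smul, inr_one,
        smul_smul, Algebra.algebraMap_eq_smul_one]
  mul_antipode_lTensor_comul := by
    ext x
    induction x using induction_on with
    | hz => simp only [map_zero]
    | hadd x y hx hy => rw [map_add, map_add, hx, hy]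
    | ht h q =>
      simp only [LinearMap.comp_apply, comul_tmul, map_sum, LinearMap.lTensor_tmul,
        LinearMap.mul'_apply, antipodeMap_tmul, counit_tmul, Algebra.linearMap_apply]
      have h1 := HopfAlgebra.sum_mul_antipode_eq_smul (ℛ k h)
      have h2 := HopfAlgebra.sum_mul_antipode_eq_smul (ℛ k q)
      have h3 : ∀ i ∈ (ℛ k h).index, ∑ j ∈ (ℛ k q).index,
          tmul a ((ℛ k h).left i) ((ℛ k q).left j) *
          (inr a (HopfAlgebra.antipode k ((ℛ k q).right j)) *
            inl a (HopfAlgebra.antipode k ((ℛ k h).right i))) =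
          counit (R := k) q • inl a ((ℛ k h).left i *
            HopfAlgebra.antipode k ((ℛ k h).right i)) := by
        intro i _
        have h4 := congrArg (fun t => inl a ((ℛ k h).left i) * inr a t *
          inl a (HopfAlgebra.antipode k ((ℛ k h).right i))) h2
        simp only [map_sum, map_smul, Finset.mul_sum, Finset.sum_mul, inr_one, mul_smul_comm,
          smul_mul_assoc, mul_one, inl_mul] at h4
        rw [← h4]
        refine Finset.sum_congr rfl fun j _ => ?_
        rw [← inr_mul, ← inl_mul_inr]
        simp only [mul_assoc]
      rw [Finset.sum_congr rfl h3, ← Finset.smul_sum, ← map_sum, h1, map_smul, inl_one,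
        smul_smul, Algebra.algebraMap_eq_smul_one, mul_comm]

end Smash
end Smash

/-! ### Wreath products -/

section Wreath

variable (k : Type u) [Field k] (A : Type v) (Q : Type w) [Ring A] [HopfAlgebra k A]
  [Ring Q] [HopfAlgebra k Q] [IsCocomm k Q]

open MeasuringCoalgebra WithConv

/-- The morphism `(Q ⊗ A ^ Q) ⊗ Q → A`, `(q ⊗ u) ⊗ c ↦ u @ (c q)`. -/
def translationEv : (Q ⊗[k] MeasuringCoalgebra k Q A) ⊗[k] Q →ₗc[k] A :=
  (ev : MeasuringCoalgebra k Q A ⊗[k] Q →ₗc[k] A).comp <|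
    (CoalgHom.lTensor (MeasuringCoalgebra k Q A)
      ((Bialgebra.mulCoalgHom k Q).comp (swap k Q Q))).comp <|
    (Coalgebra.TensorProduct.assoc k k (MeasuringCoalgebra k Q A) Q Q).toCoalgHom.comp <|
    CoalgHom.rTensor Q (swap k Q (MeasuringCoalgebra k Q A))

/-- The action `Q ⊗ A ^ Q → A ^ Q` by translation, determined by `(q ⋆ u) @ c = u @ (c q)`. -/
def translation : Q ⊗[k] MeasuringCoalgebra k Q A →ₗc[k] MeasuringCoalgebra k Q A :=
  lift (translationEv k A Q)

variable {k A Q}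

lemma evLinear_translation (q : Q) (m : MeasuringCoalgebra k Q A) (c : Q) :
    evLinear (translation k A Q (q ⊗ₜ m)) c = evLinear m (c * q) :=
  ev_lift (translationEv k A Q) (q ⊗ₜ m) c

variable (k A Q)

/-- The translation action makes `A ^ Q` a Hopf module over `Q`. -/
def translationAction : HopfAction k Q (MeasuringCoalgebra k Q A) where
  star := translation k A Q
  star_one q := by
    have h : (translation k A Q).comp ((CoalgHom.lTensor Q (oneHom k Q A)).comp
        (Coalgebra.TensorProduct.rid k k Q).symm.toCoalgHom) =
        (oneHom k Q A).comp (counitCoalgHom k Q) := by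
      apply hom_ext'
      ext q c
      change evLinear (translation k A Q (q ⊗ₜ 1)) c = evLinear (oneHom k Q A (counit q)) c
      rw [evLinear_translation, ← algebraMap_eq, evLinear_algebraMap, evLinear_one]
      change algebraMap k A (counit (c * q)) = _
      rw [Bialgebra.counit_mul, mul_comm]
    exact congr($h q).trans (algebraMap_eq _).symm
  star_mul q m m' := by
    have h : (translation k A Q).comp (CoalgHom.lTensor Q (MeasuringCoalgebra.mulHom k Q A)) =
        (MeasuringCoalgebra.mulHom k Q A).comp
        ((Coalgebra.TensorProduct.map (translation k A Q) (translation k A Q)).comp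
        ((exchange k Q Q (MeasuringCoalgebra k Q A) (MeasuringCoalgebra k Q A)).comp
        (CoalgHom.rTensor (MeasuringCoalgebra k Q A ⊗[k] MeasuringCoalgebra k Q A)
          (comulCoalgHom k Q)))) := by
      apply hom_ext'
      ext q m m' c
      change evLinear (translation k A Q (q ⊗ₜ (m * m'))) c = evLinear (MeasuringCoalgebra.mulHom k Q A
        (Coalgebra.TensorProduct.map (translation k A Q) (translation k A Q)
        (exchange k Q Q (MeasuringCoalgebra k Q A) (MeasuringCoalgebra k Q A)
          (comul q ⊗ₜ (m ⊗ₜ m'))))) c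
      rw [evLinear_translation, evLinear_mul]
      change LinearMap.mul' k A (TensorProduct.map _ _ (comul (c * q))) = _
      rw [Bialgebra.comul_mul]
      induction comul (R := k) q with
      | zero => simp
      | add y z hy hz =>
        simp only [mul_add, TensorProduct.add_tmul, map_add, LinearMap.add_apply, hy, hz]
      | tmul y z =>
        simp only [exchange_tmul, Coalgebra.TensorProduct.map_tmul]
        rw [← MeasuringCoalgebra.mul_def, evLinear_mul]
        change _ = LinearMap.mul' k A (TensorProduct.map _ _ (comul c))
        induction comul (R := k) c with
        | zero => simp
        | add a b ha hb => simp only [add_mul, map_add, ha, hb]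
        | tmul a b =>
          simp [evLinear_translation]
    refine congr($h (q ⊗ₜ (m ⊗ₜ m'))).trans ?_
    change MeasuringCoalgebra.mulHom k Q A
        (Coalgebra.TensorProduct.map (translation k A Q) (translation k A Q)
        (exchange k Q Q (MeasuringCoalgebra k Q A) (MeasuringCoalgebra k Q A)
          (comul q ⊗ₜ (m ⊗ₜ m')))) = _
    induction comul (R := k) q with
    | zero => simp
    | add y z hy hz => simp only [TensorProduct.add_tmul, map_add, hy, hz]
    | tmul y z => rfl
  one_star m := by
    have h : (translation k A Q).comp (((Bialgebra.unitBialgHom k Q :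
          k →ₗc[k] Q).rTensor (MeasuringCoalgebra k Q A)).comp
        (Coalgebra.TensorProduct.lid k (MeasuringCoalgebra k Q A)).symm.toCoalgHom) =
        CoalgHom.id k _ := by
      apply hom_ext'
      ext m c
      change evLinear (translation k A Q (algebraMap k Q 1 ⊗ₜ m)) c = evLinear m c
      rw [evLinear_translation, map_one, mul_one]
    refine Eq.trans ?_ congr($h m)
    change _ = translation k A Q (algebraMap k Q 1 ⊗ₜ m)
    rw [map_one]
  star_star q r m := by
    have h : (translation k A Q).comp ((CoalgHom.lTensor Q (translation k A Q)).comp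
        (Coalgebra.TensorProduct.assoc k k Q Q (MeasuringCoalgebra k Q A)).toCoalgHom) =
        (translation k A Q).comp
        (CoalgHom.rTensor (MeasuringCoalgebra k Q A) (Bialgebra.mulCoalgHom k Q)) := by
      apply hom_ext'
      ext q r m c
      change evLinear (translation k A Q (q ⊗ₜ translation k A Q (r ⊗ₜ m))) c =
        evLinear (translation k A Q ((q * r) ⊗ₜ m)) c
      simp only [evLinear_translation, mul_assoc]
    exact congr($h ((q ⊗ₜ r) ⊗ₜ m))

/-- The wreath product `A ≀ Q = A ^ Q # Q` of cocommutative Hopf algebras. -/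
abbrev WreathProduct : Type (max u v w) := Smash (translationAction k A Q)

end Wreath

/-- The action of a group `𝔔` on `𝔄 ^ 𝔔` by translation, `(q • f) x = f (x q)`. -/
def groupTranslation (𝔄 : Type v) (𝔔 : Type w) [Group 𝔄] [Group 𝔔] :
    𝔔 →* MulAut (𝔔 → 𝔄) where
  toFun q :=
    { toFun := fun f x => f (x * q)
      invFun := fun f x => f (x * q⁻¹)
      left_inv := fun f => by ext x; simp
      right_inv := fun f => by ext x; simp
      map_mul' := fun f g => rfl }
  map_one' := by ext f x; simp
  map_mul' q r := by ext f x; simp [mul_assoc]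

/-- The wreath product `𝔄 ≀ 𝔔 = 𝔄 ^ 𝔔 ⋊ 𝔔` of groups. -/
abbrev GroupWreathProduct (𝔄 : Type v) (𝔔 : Type w) [Group 𝔄] [Group 𝔔] : Type (max v w) :=
  (𝔔 → 𝔄) ⋊[groupTranslation 𝔄 𝔔] 𝔔

end HopfWreath

end

/-! The main point is (2), and (1) follows from it.

A function `f : X → Y` gives a group-like element of `(kY) ^ (kX)`: its linear extension is a
coalgebra morphism `kX → kY`, and the universal property turns the pairing `f ⊗ x ↦ f x` into `ofFun
: k(Y ^ X) → (kY) ^ (kX)`. Evaluation at the points of `X` recovers `f`, and distinct group-like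
elements are linearly independent, so `ofFun` is injective.

For surjectivity it suffices to treat one finite-dimensional cocommutative `B` with a morphism `F :
B ⊗ kX → kY`. Each `x ∈ X` is group-like, so `b ↦ F (b ⊗ x)` is a coalgebra morphism `B → kY`.
Pulling back the coordinate functionals of `kY`, which are idempotent for convolution, gives
idempotent operators `b ↦ ∑ α(b₂) b₁` on `B`, one for each pair `(x, y)`. They commute because `B`
is cocommutative, hence are simultaneously diagonalizable, even if `X` and `Y` are infinite, because
`B` is finite-dimensional. A nonzero joint eigenvector cannot be killed by all the idempotents of a
given `x`, so it lies over some `f : X → Y`: thus `B` is spanned by its fibres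
(`iSup_fiber_eq_top`). The fibre over `f` is a subcoalgebra on which `F (b ⊗ x) = ε(b) f(x)`, and
the uniqueness in the universal property identifies its map to `(kY) ^ (kX)` with `b ↦ ε(b) f`
(`ι_eq_of_mem_fiber`).

For (1), sending `(f, q)` to `f # q` is bijective after linear extension, by (2) tensored with `k𝔔`.
It is multiplicative because all elements involved are group-like, and group-like elements of a
measuring coalgebra are determined by their evaluations. Compatibility with antipodes is uniqueness
of inverses of group-like elements. -/

noncomputable section

namespace HopfWreath

open Coalgebra

universe u v w x

/-! ### Contraction operators on a coalgebra. -/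

section Contraction

variable {k : Type u} [Field k] {B : Type v} [AddCommGroup B] [Module k B] [Coalgebra k B]

/-- The operator `b ↦ ∑ α(b₂) b₁` on a coalgebra. -/
def contract (α : B →ₗ[k] k) : Module.End k B :=
  (TensorProduct.rid k B).toLinearMap ∘ₗ α.lTensor B ∘ₗ comul

lemma contract_apply (α : B →ₗ[k] k) (b : B) :
    contract α b = TensorProduct.rid k B (α.lTensor B (comul b)) := rfl

/-- This is `contract_contract` before coassociativity is used. Allowing an arbitrary tensor `t` in
place of `comul b` makes induction on tensors possible. -/
lemma rid_lTensor_comul_rid_lTensor (α β : B →ₗ[k] k) (t : B ⊗[k] B) :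
    TensorProduct.rid k B (β.lTensor B (comul (R := k)
      (TensorProduct.rid k B (α.lTensor B t)))) =
      TensorProduct.rid k B ((LinearMap.mul' k k ∘ₗ TensorProduct.map β α).lTensor B
        (TensorProduct.assoc k B B B ((comul (R := k) (A := B)).rTensor B t))) := by
  induction t with
  | zero => simp
  | add y z hy hz => simp only [map_add, hy, hz]
  | tmul y z =>
    simp only [LinearMap.lTensor_tmul, LinearMap.rTensor_tmul, TensorProduct.rid_tmul, map_smul]
    induction comul (R := k) y with
    | zero => simp
    | add y z hy hz => simp only [map_add, TensorProduct.add_tmul, smul_add, hy, hz]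
    | tmul y z' => simp [smul_smul, mul_comm]

/-- Contractions compose by convolution of functionals. -/
lemma contract_contract (α β : B →ₗ[k] k) (b : B) : contract β (contract α b) =
    contract (LinearMap.mul' k k ∘ₗ TensorProduct.map β α ∘ₗ comul) b := by
  rw [contract_apply, contract_apply, contract_apply, rid_lTensor_comul_rid_lTensor,
    Coalgebra.coassoc_apply, ← LinearMap.lTensor_comp_apply, LinearMap.comp_assoc]

/-- Convolution of functionals is commutative on a cocommutative coalgebra, and contractions compose
by convolution. -/
lemma commute_contract [IsCocomm k B] (α β : B →ₗ[k] k) :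
    Commute (contract α) (contract β) := by
  refine LinearMap.ext fun b => ?_
  change contract α (contract β b) = contract β (contract α b)
  rw [contract_contract, contract_contract]
  congr 2
  refine LinearMap.ext fun c => ?_
  simp only [LinearMap.comp_apply]
  conv_rhs => rw [← Coalgebra.comm_comul k c]
  induction comul (R := k) c with
  | zero => simp
  | add y z hy hz => simp only [map_add, hy, hz]
  | tmul y z => simp [mul_comm]

/-- A subspace stable under all contractions of a cocommutative coalgebra is a subcoalgebra. -/
lemma isSubcoalgebra_of_contract_mem [IsCocomm k B] (V : Submodule k B)
    (h : ∀ b ∈ V, ∀ α : B →ₗ[k] k, contract α b ∈ V) : IsSubcoalgebra V := by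
  intro b hb
  obtain ⟨q, hq⟩ := V.exists_isCompl
  let p : B →ₗ[k] V := V.projectionOnto q hq
  let p' : B →ₗ[k] B := V.subtype ∘ₗ p
  have hp' : ∀ y ∈ V, p' y = y := fun y hy => by
    simpa [p', p] using congrArg Subtype.val (Submodule.projectionOnto_apply_left hq ⟨y, hy⟩)
  -- All right contractions of `comul b` lie in `V`, so `comul b` lies in `V ⊗ B`. By
  -- cocommutativity it also lies in `B ⊗ V`, and applying the projection in both factors exhibits
  -- it in `V ⊗ V`.
  have h1 := rTensor_eq_self V p' hp' (comul b) (h b hb)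
  have h2 : p'.lTensor B (comul (R := k) b) = comul (R := k) b := by
    have hcm := Coalgebra.comm_comul k b
    conv_rhs => rw [← hcm, ← h1]
    conv_lhs => rw [← hcm]
    rw [LinearMap.rTensor, LinearMap.lTensor, TensorProduct.map_comm]
  refine ⟨TensorProduct.map p p (comul (R := k) b), ?_⟩
  rw [← LinearMap.comp_apply, ← TensorProduct.map_comp]
  change TensorProduct.map p' p' _ = _
  rw [← LinearMap.rTensor_comp_lTensor, LinearMap.comp_apply, h2, h1]

end Contraction

/-! ### Simultaneous diagonalization of commuting idempotents. -/

section Eigen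

variable {K : Type*} [Field K] {M : Type*} [AddCommGroup M] [Module K M]

/-- An idempotent is annihilated by `X (X - 1)`, which is separable over every field, also in
characteristic two. Semisimplicity allows generalized eigenspaces to be replaced by eigenspaces. -/
lemma isSemisimple_of_isIdempotentElem {p : Module.End K M} (hp : IsIdempotentElem p) :
    p.IsSemisimple := by
  refine Module.End.isSemisimple_of_squarefree_aeval_eq_zero
    (p := (Polynomial.X * (Polynomial.X - Polynomial.C 1) : Polynomial K)) ?_ ?_
  · refine (Polynomial.separable_X.mul Polynomial.separable_X_sub_C ?_).squarefree
    exact ⟨1, -1, by simp⟩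
  · simp [mul_sub, hp.eq]

lemma iSup_maxGenEigenspace_eq_top_of_isIdempotentElem {p : Module.End K M}
    (hp : IsIdempotentElem p) : ⨆ μ : K, p.maxGenEigenspace μ = ⊤ := by
  rw [(isSemisimple_of_isIdempotentElem hp).iSup_maxGenEigenspace_eq_top_iff, eq_top_iff]
  intro m _
  have hp' : p (p m) = p m := congr($hp m)
  -- The decomposition `m = p m + (m - p m)` has components of eigenvalues `1` and `0`.
  rw [← add_sub_cancel (p m) m]
  exact add_mem (Submodule.mem_iSup_of_mem 1 (Module.End.mem_eigenspace_iff.2 (by simp [hp'])))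
    (Submodule.mem_iSup_of_mem 0 (Module.End.mem_eigenspace_iff.2 (by simp [hp'])))

/-- Commuting idempotents of a finite-dimensional space are simultaneously diagonalizable. -/
lemma iSup_iInf_eigenspace_eq_top_of_isIdempotentElem [FiniteDimensional K M] {ι : Type*}
    (p : ι → Module.End K M) (hp : ∀ i, IsIdempotentElem (p i))
    (h : ∀ i j, Commute (p i) (p j)) : ⨆ χ : ι → K, ⨅ i, (p i).eigenspace (χ i) = ⊤ := by
  rw [← Module.End.iSup_iInf_maxGenEigenspace_eq_top_of_iSup_maxGenEigenspace_eq_top_of_commute p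
    (fun i j _ => h i j) fun i => iSup_maxGenEigenspace_eq_top_of_isIdempotentElem (hp i)]
  simp only [(isSemisimple_of_isIdempotentElem
    (hp _)).isFinitelySemisimple.maxGenEigenspace_eq_eigenspace]

end Eigen

/-! ### The group-like coalgebra `kY` and its coordinates. -/

section GroupLikeCoalgebra

variable {k : Type u} [Field k] {X : Type w} {Y : Type x}

variable (k) in
/-- The coefficient of `y`, as a functional. -/
def coord (y : Y) : MonoidAlgebra k Y →ₗ[k] k :=
  Finsupp.lapply y ∘ₗ (MonoidAlgebra.coeffLinearEquiv k).toLinearMap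

lemma coord_apply (y : Y) (z : MonoidAlgebra k Y) : coord k y z = z.coeff y := rfl

lemma monoidAlgebra_linearMap_ext {E : Type*} [AddCommMonoid E] [Module k E]
    {g g' : MonoidAlgebra k Y →ₗ[k] E} (h : ∀ y, g (.single y 1) = g' (.single y 1)) :
    g = g' := by
  refine MonoidAlgebra.lhom_ext' fun y => ?_
  ext
  exact h y

/-- The coordinate functional is a convolution idempotent: on basis elements it takes the values `0`
and `1`, and these equal their squares. -/
lemma mul_coord_comul (y : Y) (z : MonoidAlgebra k Y) :
    LinearMap.mul' k k (TensorProduct.map (coord k y) (coord k y) (comul z)) = coord k y z := by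
  classical
  suffices LinearMap.mul' k k ∘ₗ TensorProduct.map (coord k y) (coord k y) ∘ₗ comul =
    coord k y from congr($this z)
  refine monoidAlgebra_linearMap_ext fun y' => ?_
  by_cases h : y' = y <;> simp [coord_apply, h]

lemma contract_coord (y : Y) (z : MonoidAlgebra k Y) :
    contract (coord k y) z = .single y (coord k y z) := by
  classical
  suffices contract (coord k y) = MonoidAlgebra.lsingle y ∘ₗ coord k y from congr($this z)
  refine monoidAlgebra_linearMap_ext fun y' => ?_
  by_cases h : y' = y <;> simp [contract_apply, coord_apply, h]

/-- Since `Y` is a basis of `kY`, the space `B ⊗ kY` is a direct sum of copies of `B` indexed by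
`Y`, and the contractions with coordinates are its projections. -/
lemma eq_zero_of_lTensor_coord {B : Type v} [AddCommGroup B] [Module k B]
    (t : B ⊗[k] MonoidAlgebra k Y)
    (h : ∀ y, TensorProduct.rid k B ((coord k y).lTensor B t) = 0) : t = 0 := by
  classical
  let bs : Module.Basis Y k (MonoidAlgebra k Y) := ⟨MonoidAlgebra.coeffLinearEquiv k⟩
  apply (TensorProduct.equivFinsuppOfBasisRight (M := B) bs).injective
  rw [map_zero]
  ext y
  rw [Finsupp.zero_apply, ← h y]
  clear h
  induction t with
  | zero => simp
  | add y z hy hz => simp [hy, hz]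
  | tmul y z => simp [TensorProduct.equivFinsuppOfBasisRight_apply_tmul, bs, coord_apply]

/-- The morphism `k → C` given by a group-like element of `C`. -/
def ofGroupLike {C : Type*} [AddCommGroup C] [Module k C] [Coalgebra k C] {c : C}
    (hc : IsGroupLikeElem k c) : k →ₗc[k] C where
  toLinearMap := LinearMap.toSpanSingleton k C c
  counit_comp := by ext; simp [hc.counit_eq_one]
  map_comp_comul := by ext; simp [hc.comul_eq_tmul_self]

lemma ofGroupLike_apply {C : Type*} [AddCommGroup C] [Module k C] [Coalgebra k C] {c : C}
    (hc : IsGroupLikeElem k c) (r : k) : ofGroupLike hc r = r • c := rfl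

/-! ### Decomposition of a coalgebra with morphisms to `kY` into fibres. -/

variable {B : Type v} [AddCommGroup B] [Module k B] [Coalgebra k B]

lemma map_contract {D : Type*} [AddCommGroup D] [Module k D] [Coalgebra k D] (g : B →ₗc[k] D)
    (α : D →ₗ[k] k) (b : B) : g (contract (α ∘ₗ (g : B →ₗ[k] D)) b) = contract α (g b) := by
  rw [contract_apply, contract_apply, ← CoalgHomClass.map_comp_comul_apply]
  induction comul (R := k) b with
  | zero => simp
  | add y z hy hz => simp only [map_add, hy, hz]
  | tmul y z => simp

/-- The projection onto the part of `B` lying over `y`, for a morphism `B → kY`. -/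
def fiberProj (g : B →ₗc[k] MonoidAlgebra k Y) (y : Y) : Module.End k B :=
  contract (coord k y ∘ₗ (g : B →ₗ[k] MonoidAlgebra k Y))

lemma isIdempotentElem_fiberProj (g : B →ₗc[k] MonoidAlgebra k Y) (y : Y) :
    IsIdempotentElem (fiberProj g y) := by
  refine LinearMap.ext fun b => ?_
  change contract _ (contract _ b) = contract _ b
  rw [contract_contract]
  congr 2
  refine LinearMap.ext fun c => ?_
  have h := CoalgHomClass.map_comp_comul_apply (R := k) g c
  simp only [LinearMap.comp_apply, TensorProduct.map_comp]
  rw [h]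
  exact mul_coord_comul y (g c)

/-- Contraction with the coordinate of `y` projects `kY` onto the line of `y`, so `g b` is a
multiple of `y`. The counit, preserved by `g`, finds the factor. -/
lemma apply_eq_single_of_fiberProj_eq (g : B →ₗc[k] MonoidAlgebra k Y) {y : Y} {b : B}
    (h : fiberProj g y b = b) : g b = .single y (counit (R := k) b) := by
  have h1 : g b = .single y (coord k y (g b)) := by
    rw [← contract_coord, ← map_contract]
    exact congrArg g h.symm
  have h2 := CoalgHomClass.counit_comp_apply (R := k) g b
  rw [h1, MonoidAlgebra.counit_single] at h2
  rw [h1, ← h2]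
  rfl

/-- This replaces the assertion that the projections sum to the identity, which would be an infinite
sum for infinite `Y`. The components of `∑ b₁ ⊗ g(b₂)` are the `fiberProj g y b`, and applying the
counit to the second factor returns `b`. -/
lemma eq_zero_of_fiberProj_eq_zero (g : B →ₗc[k] MonoidAlgebra k Y) {b : B}
    (h : ∀ y, fiberProj g y b = 0) : b = 0 := by
  have h1 : (g : B →ₗ[k] MonoidAlgebra k Y).lTensor B (comul b) = 0 := by
    refine eq_zero_of_lTensor_coord _ fun y => ?_
    rw [← h y, ← LinearMap.lTensor_comp_apply]
    rfl
  have h2 := congrArg (fun t => TensorProduct.rid k B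
    ((counit (R := k) (A := MonoidAlgebra k Y)).lTensor B t)) h1
  simp only [← LinearMap.lTensor_comp_apply, CoalgHomClass.counit_comp, map_zero] at h2
  simpa using h2

/-- The part of `B` lying over `f : X → Y`, for a family of morphisms `B → kY`. -/
def fiber (g : X → B →ₗc[k] MonoidAlgebra k Y) (f : X → Y) : Submodule k B :=
  ⨅ x, (fiberProj (g x) (f x)).eigenspace 1

lemma mem_fiber {g : X → B →ₗc[k] MonoidAlgebra k Y} {f : X → Y} {b : B} :
    b ∈ fiber g f ↔ ∀ x, fiberProj (g x) (f x) b = b := by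
  simp [fiber, Submodule.mem_iInf]

variable [IsCocomm k B]

/-- Every contraction commutes with the projections, which are contractions themselves, and so
preserves their eigenspaces. -/
lemma isSubcoalgebra_fiber (g : X → B →ₗc[k] MonoidAlgebra k Y) (f : X → Y) :
    IsSubcoalgebra (fiber g f) := by
  refine isSubcoalgebra_of_contract_mem _ fun b hb α => mem_fiber.2 fun x => ?_
  refine (congr($(commute_contract _ α) b)).trans ?_
  exact congrArg (contract α) (mem_fiber.1 hb x)

/-- A finite-dimensional cocommutative coalgebra with a family of morphisms to `kY` is spanned by
the parts lying over the functions `f : X → Y`. -/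
lemma iSup_fiber_eq_top [FiniteDimensional k B] (g : X → B →ₗc[k] MonoidAlgebra k Y) :
    ⨆ f, fiber g f = ⊤ := by
  rw [eq_top_iff, ← iSup_iInf_eigenspace_eq_top_of_isIdempotentElem
    (fun i : X × Y => fiberProj (g i.1) i.2) (fun i => isIdempotentElem_fiberProj _ _)
    fun i j => commute_contract _ _]
  -- Here `b` is a joint eigenvector with eigenvalues `χ (x, y)`. Most `χ` have zero joint
  -- eigenspace, so `b = 0` is treated separately.
  refine iSup_le fun χ b hb => ?_
  simp only [Submodule.mem_iInf, Module.End.mem_eigenspace_iff] at hb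
  by_cases h0 : b = 0
  · rw [h0]; exact zero_mem _
  have h1 : ∀ x, ∃ y, χ (x, y) = 1 := by
    intro x
    by_contra! h
    -- The eigenvalues of an idempotent on `b ≠ 0` are `0` or `1`. If none of the `χ (x, y)` were
    -- `1`, all projections for this `x` would kill `b`.
    refine h0 (eq_zero_of_fiberProj_eq_zero (g x) fun y => ?_)
    have h2 : fiberProj (g x) y (fiberProj (g x) y b) = fiberProj (g x) y b :=
      congr($(isIdempotentElem_fiberProj (g x) y) b)
    have h3 := hb (x, y)
    simp only at h3
    rw [h3, map_smul, h3, smul_smul, ← sub_eq_zero, ← sub_smul] at h2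
    rw [h3]
    rcases smul_eq_zero.1 h2 with h4 | h4
    · have h5 : χ (x, y) * (χ (x, y) - 1) = 0 := by linear_combination h4
      rcases mul_eq_zero.1 h5 with h6 | h6
      · rw [h6, zero_smul]
      · exact absurd (sub_eq_zero.1 h6) (h y)
    · exact absurd h4 h0
  -- Only existence of `f x` matters: the fibres have to span, and their independence is not needed.
  choose f hf using h1
  refine Submodule.mem_iSup_of_mem f (mem_fiber.2 fun x => ?_)
  simpa [hf] using hb (x, f x)

end GroupLikeCoalgebra

/-! ### The isomorphism between `k(Y ^ X)` and `(kY) ^ (kX)`. -/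

namespace MeasuringCoalgebra

variable (k : Type u) [Field k] (X : Type w) (Y : Type x)

/-- The evaluation `k(Y ^ X) ⊗ kX → kY`, `f ⊗ x ↦ f x`. -/
def funEv : MonoidAlgebra k (X → Y) ⊗[k] MonoidAlgebra k X →ₗc[k] MonoidAlgebra k Y where
  toLinearMap := TensorProduct.lift <|
    Finsupp.lsum k (fun f : X → Y => LinearMap.toSpanSingleton k _
      (Finsupp.lsum k (fun x => MonoidAlgebra.lsingle (f x)) ∘ₗ
        (MonoidAlgebra.coeffLinearEquiv k).toLinearMap)) ∘ₗ
      (MonoidAlgebra.coeffLinearEquiv k).toLinearMap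
  counit_comp := by
    apply TensorProduct.curry_injective
    refine monoidAlgebra_linearMap_ext fun f => monoidAlgebra_linearMap_ext fun x => ?_
    simp
  map_comp_comul := by
    apply TensorProduct.curry_injective
    refine monoidAlgebra_linearMap_ext fun f => monoidAlgebra_linearMap_ext fun x => ?_
    simp

lemma funEv_single (f : X → Y) (x : X) :
    funEv k X Y (.single f 1 ⊗ₜ .single x 1) = .single (f x) 1 := by
  change TensorProduct.lift _ _ = _
  simp

/-- The morphism `k(Y ^ X) → (kY) ^ (kX)` that sends a function to its linear extension. -/
def ofFun : MonoidAlgebra k (X → Y) →ₗc[k]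
    MeasuringCoalgebra k (MonoidAlgebra k X) (MonoidAlgebra k Y) :=
  lift (funEv k X Y)

variable {k X Y}

lemma evLinear_ofFun (f : X → Y) (x : X) :
    evLinear (ofFun k X Y (.single f 1)) (.single x 1) = .single (f x) 1 :=
  (ev_lift (funEv k X Y) _ _).trans (funEv_single k X Y f x)

lemma isGroupLikeElem_ofFun (f : X → Y) :
    IsGroupLikeElem k (ofFun k X Y (.single f 1)) :=
  (MonoidAlgebra.isGroupLikeElem_single_one f).map _

lemma ofFun_single_injective :
    Function.Injective fun f : X → Y => ofFun k X Y (.single f 1) := by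
  intro f f' h
  ext x
  have h1 := congrArg (fun m => evLinear m (.single x 1)) h
  simp only [evLinear_ofFun] at h1
  exact MonoidAlgebra.single_left_injective one_ne_zero h1

/-- Evaluation alone does not suffice: different combinations of functions can have equal
evaluations, as the sums `(0,0) + (1,1)` and `(0,1) + (1,0)` show for functions from a two-point set
to `{0, 1}`. Linear independence of distinct group-like elements is used instead. -/
lemma ofFun_injective : Function.Injective (ofFun k X Y) := by
  have h : LinearIndependent k fun f : X → Y => ofFun k X Y (.single f 1) :=
    (linearIndep_groupLikeVal (R := k)).comp (fun f => ⟨_, isGroupLikeElem_ofFun f⟩)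
      fun f f' hf => ofFun_single_injective congr(GroupLike.val $hf)
  have h1 : (ofFun k X Y : MonoidAlgebra k (X → Y) →ₗ[k]
      MeasuringCoalgebra k (MonoidAlgebra k X) (MonoidAlgebra k Y)) =
      Finsupp.linearCombination k (fun f : X → Y => ofFun k X Y (.single f 1)) ∘ₗ
        (MonoidAlgebra.coeffLinearEquiv k).toLinearMap :=
    monoidAlgebra_linearMap_ext fun f => by simp
  change Function.Injective (ofFun k X Y : MonoidAlgebra k (X → Y) →ₗ[k]
      MeasuringCoalgebra k (MonoidAlgebra k X) (MonoidAlgebra k Y))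
  rw [h1]
  exact Function.Injective.comp (g := Finsupp.linearCombination k _) h (LinearEquiv.injective _)

section Slice

variable {B : Type*} [AddCommGroup B] [Module k B] [Coalgebra k B]
  {D : Type*} [AddCommGroup D] [Module k D] [Coalgebra k D]

/-- The morphism `B → D`, `b ↦ F (b ⊗ x)`, for `F : B ⊗ kX → D` and `x ∈ X`. -/
def slice (F : B ⊗[k] MonoidAlgebra k X →ₗc[k] D) (x : X) : B →ₗc[k] D :=
  F.comp
    { toLinearMap := (TensorProduct.mk k B (MonoidAlgebra k X)).flip (.single x 1)
      counit_comp := by ext; simp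
      map_comp_comul := by
        ext b
        simp only [LinearMap.comp_apply, LinearMap.flip_apply, TensorProduct.mk_apply,
          TensorProduct.comul_tmul, MonoidAlgebra.comul_single, CommSemiring.comul_apply,
          TensorProduct.map_tmul, MonoidAlgebra.lsingle_apply]
        induction comul (R := k) b with
        | zero => simp
        | add y z hy hz => simp only [map_add, TensorProduct.add_tmul, hy, hz]
        | tmul y z => simp }

lemma slice_apply (F : B ⊗[k] MonoidAlgebra k X →ₗc[k] D) (x : X) (b : B) :
    slice F x b = F (b ⊗ₜ .single x 1) := rfl

end Slice

/-- Equal evaluations do not make two elements equal, but they make two coalgebra morphisms from a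
cocommutative coalgebra equal. The comparison is therefore made on the whole fibre, which is a
subcoalgebra. -/
lemma ι_eq_of_mem_fiber (s : Stage k (MonoidAlgebra k X) (MonoidAlgebra k Y)) (f : X → Y)
    {b : Vec k s.n} (hb : b ∈ fiber (slice s.f) f) :
    ι s b = counit (R := k) b • ofFun k X Y (.single f 1) := by
  obtain ⟨n, _, _, j, -, hj⟩ := exists_vec_of_subcoalgebra (fiber (slice s.f) f)
    (Module.Finite.iff_fg.1 inferInstance) (isSubcoalgebra_fiber _ f)
  -- The right side is `b ↦ ε(b) f`, a coalgebra morphism because it factors through `k` by a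
  -- group-like element.
  have h : (ι s).comp j = (ofGroupLike (isGroupLikeElem_ofFun f)).comp (counitCoalgHom k _) := by
    refine hom_ext fun y c => ?_
    change evLinear (ι s (j y)) c =
      evLinear (counit (R := k) y • ofFun k X Y (.single f 1)) c
    congr 1
    refine monoidAlgebra_linearMap_ext fun x => ?_
    have h1 : j y ∈ fiber (slice s.f) f := hj.le ⟨y, rfl⟩
    have h2 := apply_eq_single_of_fiberProj_eq _ (mem_fiber.1 h1 x)
    rw [evLinear_ι, ← slice_apply, h2, CoalgHomClass.counit_comp_apply, map_smul,
      LinearMap.smul_apply, evLinear_ofFun]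
    simp
  obtain ⟨y, rfl⟩ := hj.ge hb
  refine congr($h y).trans ?_
  change counit (R := k) y • ofFun k X Y (.single f 1) = _
  rw [CoalgHom.coe_toLinearMap, CoalgHomClass.counit_comp_apply]

/-- The measuring coalgebra is spanned by the images of the stages, each stage is finite-dimensional
and hence spanned by its fibres, and each fibre maps to multiples of a single `f`. -/
lemma ofFun_surjective : Function.Surjective (ofFun k X Y) := by
  suffices h : ∀ m, m ∈ LinearMap.range (ofFun k X Y : MonoidAlgebra k (X → Y) →ₗ[k]
      MeasuringCoalgebra k (MonoidAlgebra k X) (MonoidAlgebra k Y)) from h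
  intro m
  induction m using induction_on with
  | hz => exact zero_mem _
  | hadd m m' h h' => exact add_mem h h'
  | hι s b =>
    have h : ⨆ f, fiber (slice s.f) f ≤
        (LinearMap.range (ofFun k X Y : MonoidAlgebra k (X → Y) →ₗ[k]
      MeasuringCoalgebra k (MonoidAlgebra k X) (MonoidAlgebra k Y))).comap
          (ι s : Vec k s.n →ₗ[k] _) :=
      iSup_le fun f b hb =>
        ⟨_, (map_smul _ _ _).trans (ι_eq_of_mem_fiber s f hb).symm⟩
    exact h (iSup_fiber_eq_top (slice s.f) ▸ Submodule.mem_top)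

variable (k X Y) in
/-- The isomorphism `k(Y ^ X) ≅ (kY) ^ (kX)`. -/
def ofFunEquiv : MonoidAlgebra k (X → Y) ≃ₗc[k]
    MeasuringCoalgebra k (MonoidAlgebra k X) (MonoidAlgebra k Y) :=
  CoalgEquiv.ofBijective (f := ofFun k X Y) ⟨ofFun_injective, ofFun_surjective⟩

end MeasuringCoalgebra

/-! ### Group-like elements in measuring coalgebras and smash products. -/

namespace MeasuringCoalgebra

section

variable {k : Type u} [Field k] {C : Type v} {D : Type w} [AddCommGroup C] [Module k C]
  [Coalgebra k C] [AddCommGroup D] [Module k D] [Coalgebra k D]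

/-- A group-like element of `D ^ C` is determined by its evaluations. -/
lemma eq_of_isGroupLikeElem {m m' : MeasuringCoalgebra k C D} (hm : IsGroupLikeElem k m)
    (hm' : IsGroupLikeElem k m') (h : evLinear m = evLinear m') : m = m' := by
  -- Group-like elements are the coalgebra morphisms from `k`, so the uniqueness in the universal
  -- property applies to them.
  have h1 : ofGroupLike hm = ofGroupLike hm' := by
    refine hom_ext fun r c => ?_
    change evLinear (r • m) c = evLinear (r • m') c
    rw [map_smul, map_smul, h]
  simpa [ofGroupLike_apply] using congr($h1 1)

end

end MeasuringCoalgebra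

lemma _root_.IsGroupLikeElem.tmul {k : Type*} [Field k] {C D : Type*} [AddCommGroup C]
    [Module k C] [Coalgebra k C] [AddCommGroup D] [Module k D] [Coalgebra k D] {c : C} {d : D}
    (hc : IsGroupLikeElem k c) (hd : IsGroupLikeElem k d) : IsGroupLikeElem k (c ⊗ₜ[k] d) where
  counit_eq_one := by simp [TensorProduct.counit_tmul, hc.counit_eq_one, hd.counit_eq_one]
  comul_eq_tmul_self := by
    simp [TensorProduct.comul_tmul, hc.comul_eq_tmul_self, hd.comul_eq_tmul_self]

namespace Smash

variable {k : Type u} [Field k] {Q : Type v} {H : Type w} [Ring Q] [Ring H] [Bialgebra k Q]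
  [Bialgebra k H] (a : HopfAction k Q H)

lemma isGroupLikeElem_tmul {h : H} {q : Q} (hh : IsGroupLikeElem k h)
    (hq : IsGroupLikeElem k q) : IsGroupLikeElem k (tmul a h q) :=
  hh.tmul hq

lemma tmul_mul_tmul_of_isGroupLikeElem [IsCocomm k Q] (h h' : H) {q : Q}
    (hq : IsGroupLikeElem k q) (r : Q) :
    tmul a h q * tmul a h' r = tmul a (h * a.star (q ⊗ₜ h')) (q * r) := by
  rw [tmul_mul]
  change mulL a h (Coalgebra.TensorProduct.map a.star (Bialgebra.mulCoalgHom k Q)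
    (exchange k Q Q H Q (comul q ⊗ₜ (h' ⊗ₜ r)))) = _
  rw [hq.comul_eq_tmul_self]
  rfl

end Smash

/-! ### The wreath product of group algebras. -/

section GroupWreath

open MeasuringCoalgebra WithConv

variable {k : Type u} [Field k] {𝔄 : Type v} {𝔔 : Type w} [Group 𝔄]

/-- Here and in the next two lemmas both sides are group-like, so only their evaluations at points
have to be compared. -/
lemma ofFun_single_one {X : Type*} :
    ofFun k X 𝔄 (.single 1 1) = 1 := by
  refine eq_of_isGroupLikeElem (isGroupLikeElem_ofFun _) .one ?_
  refine monoidAlgebra_linearMap_ext fun x => ?_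
  rw [evLinear_ofFun, evLinear_one]
  change _ = algebraMap k (MonoidAlgebra k 𝔄) (counit (R := k) (MonoidAlgebra.single x (1 : k)))
  simp

lemma ofFun_single_mul {X : Type*} (f f' : X → 𝔄) :
    ofFun k X 𝔄 (.single (f * f') 1) = ofFun k X 𝔄 (.single f 1) * ofFun k X 𝔄 (.single f' 1) := by
  refine eq_of_isGroupLikeElem (isGroupLikeElem_ofFun _)
    ((isGroupLikeElem_ofFun f).mul (isGroupLikeElem_ofFun f')) ?_
  refine monoidAlgebra_linearMap_ext fun x => ?_
  rw [evLinear_ofFun, evLinear_mul]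
  change _ = LinearMap.mul' k _ (TensorProduct.map _ _ (comul (MonoidAlgebra.single x (1 : k))))
  simp [evLinear_ofFun]

variable [Group 𝔔]

lemma translation_ofFun (q : 𝔔) (f : 𝔔 → 𝔄) :
    translation k (MonoidAlgebra k 𝔄) (MonoidAlgebra k 𝔔)
      (.single q 1 ⊗ₜ ofFun k 𝔔 𝔄 (.single f 1)) =
      ofFun k 𝔔 𝔄 (.single (groupTranslation 𝔄 𝔔 q f) 1) := by
  refine eq_of_isGroupLikeElem (((MonoidAlgebra.isGroupLikeElem_single_one q).tmul
    (isGroupLikeElem_ofFun f)).map _) (isGroupLikeElem_ofFun _) ?_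
  refine monoidAlgebra_linearMap_ext fun x => ?_
  rw [evLinear_ofFun, evLinear_translation, MonoidAlgebra.single_mul_single, one_mul,
    evLinear_ofFun]
  rfl

variable (k 𝔄 𝔔)

/-- The element `f # q` of the wreath product of group algebras, for an element `(f, q)` of the
wreath product of groups. -/
def wreathOf : GroupWreathProduct 𝔄 𝔔 →*
    WreathProduct k (MonoidAlgebra k 𝔄) (MonoidAlgebra k 𝔔) where
  toFun g := Smash.tmul _ (ofFun k 𝔔 𝔄 (.single g.left 1)) (.single g.right 1)
  map_one' := by
    rw [SemidirectProduct.one_left, SemidirectProduct.one_right, ofFun_single_one]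
    rfl
  map_mul' g g' := by
    rw [Smash.tmul_mul_tmul_of_isGroupLikeElem _ _ _ (MonoidAlgebra.isGroupLikeElem_single_one _),
      MonoidAlgebra.single_mul_single, one_mul, SemidirectProduct.mul_left,
      SemidirectProduct.mul_right, ofFun_single_mul, ← translation_ofFun]
    rfl

variable {k 𝔄 𝔔}

lemma isGroupLikeElem_wreathOf (g : GroupWreathProduct 𝔄 𝔔) :
    IsGroupLikeElem k (wreathOf k 𝔄 𝔔 g) :=
  Smash.isGroupLikeElem_tmul _ (isGroupLikeElem_ofFun _)
    (MonoidAlgebra.isGroupLikeElem_single_one _)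

variable (k 𝔄 𝔔)

/-- The linear extension of `(f, q) ↦ f # q`. -/
def wreathHom : MonoidAlgebra k (GroupWreathProduct 𝔄 𝔔) →ₐc[k]
    WreathProduct k (MonoidAlgebra k 𝔄) (MonoidAlgebra k 𝔔) :=
  .ofAlgHom (MonoidAlgebra.lift k _ _ (wreathOf k 𝔄 𝔔))
    -- Counit and comultiplication need checking only on group elements, whose images are
    -- group-like.
    (by ext g; simp [(isGroupLikeElem_wreathOf g).counit_eq_one])
    (by ext g; simp [(isGroupLikeElem_wreathOf g).comul_eq_tmul_self])

variable {k 𝔄 𝔔}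

lemma wreathHom_single (g : GroupWreathProduct 𝔄 𝔔) :
    wreathHom k 𝔄 𝔔 (.single g 1) = wreathOf k 𝔄 𝔔 g := by
  change MonoidAlgebra.lift k _ _ (wreathOf k 𝔄 𝔔) _ = _
  simp

/-- As a vector space, `k(𝔄 ≀ 𝔔)` is `k(𝔄 ^ 𝔔) ⊗ k𝔔`, and part (2) identifies its first factor with
`(k𝔄) ^ (k𝔔)`. This chain of linear isomorphisms agrees with `wreathHom` on the basis of group
elements. -/
lemma wreathHom_bijective : Function.Bijective (wreathHom k 𝔄 𝔔) := by
  let e : MonoidAlgebra k (GroupWreathProduct 𝔄 𝔔) ≃ₗ[k]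
      MeasuringCoalgebra k (MonoidAlgebra k 𝔔) (MonoidAlgebra k 𝔄) ⊗[k] MonoidAlgebra k 𝔔 :=
    MonoidAlgebra.coeffLinearEquiv k ≪≫ₗ
      Finsupp.domLCongr SemidirectProduct.equivProd ≪≫ₗ
      (finsuppTensorFinsupp' k (𝔔 → 𝔄) 𝔔).symm ≪≫ₗ
      TensorProduct.congr
        ((MonoidAlgebra.coeffLinearEquiv k).symm ≪≫ₗ (ofFunEquiv k 𝔔 𝔄).toLinearEquiv)
        (MonoidAlgebra.coeffLinearEquiv k).symm
  let l : MonoidAlgebra k (GroupWreathProduct 𝔄 𝔔) →ₗ[k]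
      MeasuringCoalgebra k (MonoidAlgebra k 𝔔) (MonoidAlgebra k 𝔄) ⊗[k] MonoidAlgebra k 𝔔 :=
    (wreathHom k 𝔄 𝔔).toCoalgHom.toLinearMap
  have h : l = e.toLinearMap := by
    refine monoidAlgebra_linearMap_ext fun g => ?_
    refine (wreathHom_single g).trans ?_
    simp [e, SemidirectProduct.equivProd,
      finsuppTensorFinsupp'_symm_single_eq_single_one_tmul]
    rfl
  change Function.Bijective l
  rw [h]
  exact e.bijective

variable (k 𝔄 𝔔)

/-- The wreath product of group algebras is the group algebra of the wreath product. -/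
def wreathEquiv : MonoidAlgebra k (GroupWreathProduct 𝔄 𝔔) ≃ₐc[k]
    WreathProduct k (MonoidAlgebra k 𝔄) (MonoidAlgebra k 𝔔) :=
  BialgEquiv.ofBijective (wreathHom k 𝔄 𝔔) wreathHom_bijective

variable {k 𝔄 𝔔}

/-- A bialgebra morphism from a group algebra commutes with antipodes. -/
lemma map_antipode_monoidAlgebra {G H : Type*} [Group G] [Ring H] [HopfAlgebra k H]
    (e : MonoidAlgebra k G →ₐc[k] H) (z : MonoidAlgebra k G) :
    e (HopfAlgebra.antipode k z) = HopfAlgebra.antipode k (e z) := by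
  suffices (e : _ →ₗ[k] H) ∘ₗ HopfAlgebra.antipode k = HopfAlgebra.antipode k ∘ₗ (e : _ →ₗ[k] H)
    from congr($this z)
  refine monoidAlgebra_linearMap_ext fun g => ?_
  change e (HopfAlgebra.antipode k (.single g 1)) = HopfAlgebra.antipode k (e (.single g 1))
  have hg := (MonoidAlgebra.isGroupLikeElem_single_one (R := k) (A := k) g)
  -- The antipode inverts group-like elements, and `e` maps `g` to a group-like element; so both
  -- sides are inverses of `e g`.
  refine left_inv_eq_right_inv (a := e (.single g 1)) ?_ (hg.map e).mul_antipode_cancel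
  rw [← map_mul, hg.antipode_mul_cancel, map_one]

end GroupWreath

end HopfWreath

end

theorem theoremB (k : Type*) [Field k] (𝔄 𝔔 : Type*) [Group 𝔄] [Group 𝔔] (X Y : Type*) :
    (∃ e : HopfWreath.WreathProduct k (MonoidAlgebra k 𝔄) (MonoidAlgebra k 𝔔) ≃ₐc[k]
        MonoidAlgebra k (HopfWreath.GroupWreathProduct 𝔄 𝔔),
      ∀ z, e (HopfAlgebra.antipode k z) = HopfAlgebra.antipode k (e z)) ∧
    Nonempty (HopfWreath.MeasuringCoalgebra k (MonoidAlgebra k X) (MonoidAlgebra k Y) ≃ₗc[k]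
      MonoidAlgebra k (X → Y)) := by
  refine ⟨⟨(HopfWreath.wreathEquiv k 𝔄 𝔔).symm, fun z => ?_⟩,
    ⟨(HopfWreath.MeasuringCoalgebra.ofFunEquiv k X Y).symm⟩⟩
  -- Compatibility with antipodes is known for morphisms out of a group algebra, so the claim is
  -- transported along `wreathEquiv`, the inverse of the required isomorphism.
  apply (HopfWreath.wreathEquiv k 𝔄 𝔔).injective
  refine (BialgEquiv.apply_symm_apply (HopfWreath.wreathEquiv k 𝔄 𝔔) _).trans
    (Eq.trans ?_ (HopfWreath.map_antipode_monoidAlgebra (HopfWreath.wreathHom k 𝔄 𝔔) _).symm)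
  exact congrArg _ (BialgEquiv.apply_symm_apply (HopfWreath.wreathEquiv k 𝔄 𝔔) z).symm
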